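/- A $3$-graph is a $3$-uniform hypergraph, i.e. a vertex set together with a set of $3$-element subsets of it, called edges. Let $K_{2,2,7}^{(3)}$ denote the complete $3$-partite $3$-graph whose vertex set is the union of pairwise disjoint sets $V_1,V_2,V_3$ with $|V_1|=2$, $|V_2|=2$, $|V_3|=7$, and whose edges are all the sets that contain exactly one vertex from each $V_i$. For a $3$-graph $\mathcal{H}$, let $\mathrm{ex}(n,\mathcal{H})$ denote the maximum number of edges in a $3$-graph on $n$ vertices that contains no copy of $\mathcal{H}$ as a (not necessarily induced) subhypergraph. **Theorem.** As $n\to\infty$, $$\mathrm{ex}\bigl(n,K_{2,2,7}^{(3)}\bigr)\;\geqslant\;\frac{1}{27}\,n^{19/7}+o\bigl(n^{19/7}\bigr),$$ that is, there is a function $h:\mathbb{N}\to\mathbb{R}$ with $h(n)/n^{19/7}\to 0$ as $n\to\infty$ such that $\mathrm{ex}(n,K_{2,2,7}^{(3)})\geqslant \frac{1}{27}n^{19/7}+h(n)$ for every $n\in\mathbb{N}$. -/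

import Mathlib

open Asymptotics Filter

namespace Hypergraph

/-- `G` is an `r`-graph, that is, an `r`-uniform hypergraph: each edge has exactly `r` elements. -/
def IsUniform {α : Type*} (G : Hypergraph α) (r : ℕ) : Prop :=
  ∀ e ∈ G.edgeSet, e.encard = r

/-- `G` contains a copy of `H` as a (not necessarily induced) subhypergraph: some injection of the
vertices of `H` into the vertices of `G` sends every edge of `H` to an edge of `G`. -/
def ContainsCopy {α β : Type*} (G : Hypergraph α) (H : Hypergraph β) : Prop :=
  ∃ f : β → α, Set.InjOn f H.vertexSet ∧ Set.MapsTo f H.vertexSet G.vertexSet ∧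
    ∀ e ∈ H.edgeSet, f '' e ∈ G.edgeSet

/-- `G` is `H`-free: it contains no copy of `H`. -/
def IsFree {α β : Type*} (G : Hypergraph α) (H : Hypergraph β) : Prop :=
  ¬ G.ContainsCopy H

/-- The complete `r`-partite `r`-graph with parts of sizes `s 0, …, s (r - 1)`: the `i`-th part is
`{i} × Fin (s i)`, and the edges are the sets that consist of exactly one vertex from each part. -/
def completePartite {r : ℕ} (s : Fin r → ℕ) : Hypergraph (Σ i : Fin r, Fin (s i)) where
  vertexSet := Set.univ
  edgeSet := {e | ∃ c : ∀ i : Fin r, Fin (s i), e = Set.range fun i => ⟨i, c i⟩}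
  subset_vertexSet_of_mem_edgeSet' := fun _ _ => Set.subset_univ _

/-- The numbers of edges of the `H`-free `r`-graphs on the `n` vertices `Fin n`. -/
def freeEdgeCounts (r n : ℕ) {β : Type*} (H : Hypergraph β) : Set ℕ :=
  {m | ∃ G : Hypergraph (Fin n), G.vertexSet = Set.univ ∧ G.IsUniform r ∧ G.IsFree H ∧
    G.edgeSet.ncard = m}

/-- The Turán number `ex(n, H)` of an `r`-graph `H`: the maximum number of edges of an `H`-free
`r`-graph on `n` vertices. -/
noncomputable def turanNumber (r n : ℕ) {β : Type*} (H : Hypergraph β) : ℕ :=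
  sSup (freeEdgeCounts r n H)

/-- The supremum in the definition of `ex(n, H)` is a maximum as soon as `H` has an edge. -/
theorem isGreatest_turanNumber (r n : ℕ) {β : Type*} (H : Hypergraph β)
    (hH : H.edgeSet.Nonempty) :
    IsGreatest (freeEdgeCounts r n H) (turanNumber r n H) := by
  have hb : BddAbove (freeEdgeCounts r n H) := by
    refine ⟨(Set.univ : Set (Set (Fin n))).ncard, ?_⟩
    rintro m ⟨G, -, -, -, rfl⟩
    exact Set.ncard_le_ncard (Set.subset_univ _) (Set.toFinite _)
  have hn : (freeEdgeCounts r n H).Nonempty := by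
    refine ⟨0, ⟨Set.univ, ∅, by simp⟩, rfl, by simp [IsUniform], ?_, by simp⟩
    rintro ⟨f, -, -, hf⟩
    obtain ⟨e, he⟩ := hH
    exact absurd (hf e he) (Set.notMem_empty _)
  exact ⟨Nat.sSup_mem hn hb, fun m hm => le_csSup hb hm⟩

end Hypergraph

/-! The construction gives order `n ^ (11 / 4)`, and `11 / 4 = 19 / 7 + 1 / 28`, so the constant `1
/ 27` is reached with room to spare.

Let `F` have `t` elements and let `K` be its cubic extension. The map `z ↦ D.vec z` puts the `t ^ 3`
points of `K` into an eight-dimensional `F`-space, as points of a twisted form of the Segre variety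
of three projective lines. That variety has degree six, so three linear forms should have at most
six common zeros unless they contain a curve. A vertex is a point of `K` with a nonzero label from a
set `C` of about `t / 12` scalars. A random trilinear form `T` relates three vertices when its value
at the points is the product of the labels. With `N = t ^ 3 * C.card` vertices in each part, about
`N ^ 3 / t` triples are related.

The common neighbours of two pairs of vertices satisfy four equations. Eliminating the unknown label
leaves three linear forms that vanish at the point, and the remaining equation determines the label.
If three independent forms have seven zeros, then four of these lie on a circle, a Möbius image of
the projective line over `F` (`exists_concyclic`). Circles embed as twisted cubics, so the forms
vanish on the whole circle (`eq_zero_on_circle`) and have about `t ^ 4` concyclic quadruples of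
zeros. Such quadruples are rare on average: double counting gives `sum_card_zeros_le`, and with the
labels `sum_card_common_le`.

Hence the related triples in a configuration with seven common neighbours are on average at most
half of all related triples, over all orders of the parts. Deleting them leaves enough edges for a
suitable `T` (`exists_card_kept`), and no copy of the forbidden graph survives
(`exists_notMem_kept`). A prime `t` with `t ^ 4` of order `n` is supplied by Bertrand's postulate.
-/

namespace CubicCircle

/-! ### Identities for an automorphism of order three -/

section Algebra

variable {K : Type*} [Field K] (σ : K →+* K)

/-- The product of the two other conjugates of `z`. -/
def adj (z : K) : K := σ z * σ (σ z)

/-- The cross ratio of the four points is fixed by `σ`: they lie on a circle, that is, on the image of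
the projective line of the fixed field under a Möbius map. -/
def Concyclic (a b c d : K) : Prop :=
  σ ((d - a) * (b - c)) * ((d - c) * (b - a)) = (d - a) * (b - c) * σ ((d - c) * (b - a))

variable {σ}

theorem eq_zero_of_mul_fixed {y x a : K} (hy : σ y = y) (hx : σ x = x) (ha : σ a ≠ a)
    (h : x + y * a = 0) : y = 0 ∧ x = 0 := by
  have h1 := congrArg σ h
  simp only [map_add, map_mul, map_zero, hy, hx] at h1
  have h2 : y * (σ a - a) = 0 := by linear_combination h1 - h
  have hy0 : y = 0 := (mul_eq_zero.1 h2).resolve_right (sub_ne_zero.2 ha)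
  refine ⟨hy0, ?_⟩
  simpa [hy0] using h

/-- Conjugating both relations and eliminating `b` leaves a product in which every factor except `σ
a - a` has fixed coefficients. In geometric terms, the points at infinity, 0, 1, `a`, `b` are
represented by independent vectors. -/
theorem adj_triple_independent (hσ : ∀ x, σ (σ (σ x)) = x) {x y w a b : K}
    (hx : σ x = x) (hy : σ y = y) (hw : σ w = w) (ha : σ a ≠ a) (hb : σ b ≠ b) (hab : a ≠ b)
    (h : x + y * a + w * b = 0) (h' : x + y * adj σ a + w * adj σ b = 0) :
    x = 0 ∧ y = 0 ∧ w = 0 := by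
  have h1 := congrArg σ h
  simp only [map_add, map_mul, map_zero, hy, hx, hw] at h1
  have h2 := congrArg σ h1
  simp only [map_add, map_mul, map_zero, hy, hx, hw] at h2
  have h3 := congrArg σ h'
  unfold adj at h' h3
  simp only [map_add, map_mul, map_zero, hy, hx, hw, hσ] at h3
  have key : (σ a - a) * (y * (x + (w + y) * σ (σ a))) = 0 := by
    linear_combination w * h' - w * h3 - (w * σ (σ b)) * h1 + (x + y * σ a) * h2
      + w * σ (σ b) * h - (x + y * a) * h2
  have key2 := (mul_eq_zero.1 key).resolve_left (sub_ne_zero.2 ha)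
  rcases mul_eq_zero.1 key2 with hy0 | hz
  · subst hy0
    have : x + w * b = 0 := by linear_combination h
    obtain ⟨h4, h5⟩ := eq_zero_of_mul_fixed hw hx hb this
    exact ⟨h5, rfl, h4⟩
  · have ha2 : σ (σ (σ a)) ≠ σ (σ a) := by
      intro hh
      apply ha
      have := congrArg σ hh
      rwa [hσ a] at this
    obtain ⟨h4, h5⟩ := eq_zero_of_mul_fixed (by simp [hw, hy]) hx ha2 hz
    have h6 : w * (b - a) = 0 := by linear_combination h - h5 - a * h4
    have hw0 : w = 0 := (mul_eq_zero.1 h6).resolve_right (sub_ne_zero.2 hab.symm)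
    exact ⟨h5, by simpa [hw0] using h4, hw0⟩

/-- The vectors orthogonal to two non-proportional vectors are proportional. -/
theorem cross_eq_zero_of_orthogonal {r₁ r₂ r₃ s₁ s₂ s₃ p₁ p₂ p₃ q₁ q₂ q₃ : K}
    (hrp : r₁ * p₁ + r₂ * p₂ + r₃ * p₃ = 0) (hrq : r₁ * q₁ + r₂ * q₂ + r₃ * q₃ = 0)
    (hsp : s₁ * p₁ + s₂ * p₂ + s₃ * p₃ = 0) (hsq : s₁ * q₁ + s₂ * q₂ + s₃ * q₃ = 0) :
    (r₁ * s₂ = r₂ * s₁ ∧ r₁ * s₃ = r₃ * s₁ ∧ r₂ * s₃ = r₃ * s₂) ∨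
      (p₁ * q₂ = p₂ * q₁ ∧ p₁ * q₃ = p₃ * q₁) := by
  by_cases hm : p₁ * q₂ - p₂ * q₁ = 0 ∧ p₁ * q₃ - p₃ * q₁ = 0
  · exact Or.inr ⟨sub_eq_zero.1 hm.1, sub_eq_zero.1 hm.2⟩
  left
  rw [not_and_or] at hm
  have a1 : r₃ * (p₃ * q₁ - p₁ * q₃) = r₂ * (p₁ * q₂ - p₂ * q₁) := by
    linear_combination q₁ * hrp - p₁ * hrq
  have a2 : r₁ * (p₁ * q₂ - p₂ * q₁) = r₃ * (p₂ * q₃ - p₃ * q₂) := by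
    linear_combination q₂ * hrp - p₂ * hrq
  have a3 : r₂ * (p₂ * q₃ - p₃ * q₂) = r₁ * (p₃ * q₁ - p₁ * q₃) := by
    linear_combination q₃ * hrp - p₃ * hrq
  have b1 : s₃ * (p₃ * q₁ - p₁ * q₃) = s₂ * (p₁ * q₂ - p₂ * q₁) := by
    linear_combination q₁ * hsp - p₁ * hsq
  have b2 : s₁ * (p₁ * q₂ - p₂ * q₁) = s₃ * (p₂ * q₃ - p₃ * q₂) := by
    linear_combination q₂ * hsp - p₂ * hsq
  have b3 : s₂ * (p₂ * q₃ - p₃ * q₂) = s₁ * (p₃ * q₁ - p₁ * q₃) := by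
    linear_combination q₃ * hsp - p₃ * hsq
  rcases hm with hm | hm
  · refine ⟨mul_right_cancel₀ hm ?_, mul_right_cancel₀ hm ?_, mul_right_cancel₀ hm ?_⟩
    · linear_combination s₂ * a2 + s₁ * a1 + r₃ * b3
    · linear_combination s₃ * a2 - r₃ * b2
    · linear_combination -s₃ * a1 + r₃ * b1
  · refine ⟨mul_right_cancel₀ hm ?_, mul_right_cancel₀ hm ?_, mul_right_cancel₀ hm ?_⟩
    · linear_combination s₂ * a3 - r₂ * b3
    · linear_combination s₃ * a3 + s₁ * a1 + r₂ * b2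
    · linear_combination s₂ * a1 - r₂ * b1

/-- The hypotheses are two minors of the coefficient vectors in `pencil_relation` and
`pencil_relation'`, with the conjugates as free variables. Each factor of the conclusion is a
degeneracy: `a = 1`, `a` fixed, or `1`, `a`, `b` concyclic with infinity or with 0. -/
theorem difference_identity {a₀ a₁ a₂ b₀ b₁ b₂ : K}
    (h₁ : (a₀ - a₁) * (1 - a₂) * ((b₀ - b₂) * (1 - b₁)) =
      (b₀ - b₁) * (1 - b₂) * ((a₀ - a₂) * (1 - a₁)))
    (h₂ : (a₀ - a₁) * (1 - a₂) * ((a₀ * b₂ - a₂ * b₀) * (b₁ - a₁)) =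
      (a₀ * b₁ - a₁ * b₀) * (b₂ - a₂) * ((a₀ - a₂) * (1 - a₁))) :
    (1 - a₀) * ((a₀ - a₁) * (a₀ - a₂)) *
      (((b₁ - 1) * (a₂ - 1) - (b₂ - 1) * (a₁ - 1)) *
        ((1 - b₁) * b₂ * a₁ * (1 - a₂) - (1 - b₂) * b₁ * a₂ * (1 - a₁))) = 0 := by
  linear_combination
    (-((a₀ - a₁) * (1 - a₂) * a₂ * (a₁ - b₁) - (a₀ - a₂) * (1 - a₁) * a₁ * (a₂ - b₂))) * h₁
    + ((a₀ - a₁) * (1 - a₂) * (1 - b₁) - (a₀ - a₂) * (1 - a₁) * (1 - b₂)) * h₂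

end Algebra

/-! ### Two further points in normalized position -/

section Core

variable {K : Type*} [Field K] {σ : K →+* K}

theorem map_map_eq_self_iff (hσ : ∀ x, σ (σ (σ x)) = x) {a : K} (h : σ (σ a) = a) : σ a = a := by
  have := congrArg σ h
  rw [hσ] at this
  exact this.symm

theorem adj_div (z w : K) : adj σ (z / w) = adj σ z / adj σ w := by
  simp only [adj, map_div₀, div_mul_div_comm]

theorem mul_adj_fixed (hσ : ∀ x, σ (σ (σ x)) = x) (z : K) : σ (z * adj σ z) = z * adj σ z := by
  simp only [adj, map_mul, hσ]; ring

theorem div_fixed_iff {a b : K} (ha : a ≠ 0) : σ (b / a) = b / a ↔ b * σ a = σ b * a := by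
  have : σ a ≠ 0 := (map_ne_zero σ).2 ha
  rw [map_div₀, div_eq_div_iff this ha]
  exact ⟨fun h => h.symm, fun h => h.symm⟩

theorem adj_triple_independent_ratio (hσ : ∀ x, σ (σ (σ x)) = x) {x y w a b c : K}
    (hx : σ x = x) (hy : σ y = y) (hw : σ w = w) (hba : b * σ a ≠ σ b * a)
    (hca : c * σ a ≠ σ c * a) (hbc : b ≠ c)
    (h : x * a + y * b + w * c = 0) (h' : x * adj σ a + y * adj σ b + w * adj σ c = 0) :
    x = 0 ∧ y = 0 ∧ w = 0 := by
  have ha0 : a ≠ 0 := by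
    rintro rfl
    simp at hba
  have ha1 : adj σ a ≠ 0 := by simp [adj, ha0]
  refine adj_triple_independent hσ (a := b / a) (b := c / a) hx hy hw
    (fun hh => hba ((div_fixed_iff ha0).1 hh)) (fun hh => hca ((div_fixed_iff ha0).1 hh))
    (fun hh => hbc ((div_left_inj' ha0).1 hh)) ?_ ?_
  · field_simp
    linear_combination h
  · rw [adj_div, adj_div]
    field_simp
    linear_combination h'

/-- A vanishing coefficient would make `c` dependent on only two of 1, `a`, `b`, against the
independence of such triples. -/
theorem coeff_ne_zero (hσ : ∀ x, σ (σ (σ x)) = x) {x y w a b c : K}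
    (hx : σ x = x) (hy : σ y = y) (hw : σ w = w) (ha : σ a ≠ a) (hb : σ b ≠ b) (hc : σ c ≠ c)
    (hca : c ≠ a) (hcb : c ≠ b) (hba : b * σ a ≠ σ b * a) (hca' : c * σ a ≠ σ c * a)
    (h : c = x + y * a + w * b) (h' : adj σ c = x + y * adj σ a + w * adj σ b) :
    x ≠ 0 ∧ y ≠ 0 ∧ w ≠ 0 := by
  refine ⟨?_, ?_, ?_⟩
  · rintro rfl
    have := adj_triple_independent_ratio hσ (x := y) (y := w) (w := -1) hy hw (by simp) hba hca'
      hcb.symm (by linear_combination -h) (by linear_combination -h')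
    simp at this
  · rintro rfl
    have := adj_triple_independent hσ (x := x) (y := w) (w := -1) hx hw (by simp) hb hc
      hcb.symm (by linear_combination -h) (by linear_combination -h')
    simp at this
  · rintro rfl
    have := adj_triple_independent hσ (x := x) (y := y) (w := -1) hx hy (by simp) ha hc
      hca.symm (by linear_combination -h) (by linear_combination -h')
    simp at this

/-- The norm `c * adj σ c` is fixed by `σ`. Expanded in `x`, `y`, `w`, the squares `x ^ 2`, `y ^ 2`,
`w ^ 2` drop out because 1 and the norms of `a` and `b` are fixed as well. -/
theorem pencil_relation (hσ : ∀ x, σ (σ (σ x)) = x) {x y w a b c : K}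
    (hx : σ x = x) (hy : σ y = y) (hw : σ w = w)
    (h : c = x + y * a + w * b) (h' : adj σ c = x + y * adj σ a + w * adj σ b) :
    x * y * ((a - σ a) * (1 - σ (σ a))) + x * w * ((b - σ b) * (1 - σ (σ b))) +
        y * w * ((a * σ b - σ a * b) * (σ (σ b) - σ (σ a))) = 0 := by
  have hc := mul_adj_fixed hσ c
  have ha := mul_adj_fixed hσ a
  have hb := mul_adj_fixed hσ b
  rw [h', h] at hc
  simp only [adj, map_mul, map_add, hx, hy, hw, hσ] at hc ha hb
  linear_combination -hc + y ^ 2 * ha + w ^ 2 * hb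

theorem pencil_relation' (hσ : ∀ x, σ (σ (σ x)) = x) {x y w a b c : K}
    (hx : σ x = x) (hy : σ y = y) (hw : σ w = w)
    (h : c = x + y * a + w * b) (h' : adj σ c = x + y * adj σ a + w * adj σ b) :
    x * y * ((a - σ (σ a)) * (1 - σ a)) + x * w * ((b - σ (σ b)) * (1 - σ b)) +
        y * w * ((a * σ (σ b) - σ (σ a) * b) * (σ b - σ a)) = 0 := by
  have := congrArg σ (congrArg σ (pencil_relation hσ hx hy hw h h'))
  simp only [map_add, map_mul, map_sub, map_one, map_zero, hx, hy, hw, hσ] at this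
  linear_combination -this

/-- The vectors `(x * y, x * w, y * w)` of `c` and of `d` are orthogonal to the same two coefficient
vectors. If they are proportional, then `c / d` is fixed and `c`, `d` are concyclic with 0 and
infinity. Otherwise the coefficient vectors are proportional and `difference_identity` applies. -/
theorem not_two_extra_points (hσ : ∀ x, σ (σ (σ x)) = x) {a b c d x y w x' y' w' : K}
    (hx : σ x = x) (hy : σ y = y) (hw : σ w = w)
    (hx' : σ x' = x') (hy' : σ y' = y') (hw' : σ w' = w')
    (ha : σ a ≠ a) (hb : σ b ≠ b) (hc : σ c ≠ c) (hd : σ d ≠ d)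
    (hca : c ≠ a) (hcb : c ≠ b) (hda : d ≠ a) (hdb : d ≠ b)
    (hba' : b * σ a ≠ σ b * a) (hca' : c * σ a ≠ σ c * a) (hda' : d * σ a ≠ σ d * a)
    (hdc : d * σ c ≠ σ d * c)
    (h₁ : (b - 1) * σ (a - 1) ≠ σ (b - 1) * (a - 1))
    (h₀ : (1 - b) * a * σ (b * (1 - a)) ≠ σ ((1 - b) * a) * (b * (1 - a)))
    (hC : c = x + y * a + w * b) (hC' : adj σ c = x + y * adj σ a + w * adj σ b)
    (hD : d = x' + y' * a + w' * b) (hD' : adj σ d = x' + y' * adj σ a + w' * adj σ b) :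
    False := by
  obtain ⟨hx0, hy0, hw0⟩ := coeff_ne_zero hσ hx hy hw ha hb hc hca hcb hba' hca' hC hC'
  obtain ⟨hx0', hy0', hw0'⟩ := coeff_ne_zero hσ hx' hy' hw' ha hb hd hda hdb hba' hda' hD hD'
  rcases cross_eq_zero_of_orthogonal (pencil_relation hσ hx hy hw hC hC')
    (pencil_relation' hσ hx hy hw hC hC') (pencil_relation hσ hx' hy' hw' hD hD')
    (pencil_relation' hσ hx' hy' hw' hD hD') with ⟨e1, e2, -⟩ | ⟨e1, e2⟩
  · have e1' : y * w' = w * y' := by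
      have : x * x' ≠ 0 := mul_ne_zero hx0 hx0'
      apply mul_left_cancel₀ this
      linear_combination e1
    have e2' : x * w' = w * x' := by
      have : y * y' ≠ 0 := mul_ne_zero hy0 hy0'
      apply mul_left_cancel₀ this
      linear_combination e2
    have hcd : c * w' = w * d := by
      rw [hC, hD]; linear_combination a * e1' + e2'
    have hcd' : σ c * w' = w * σ d := by
      have := congrArg σ hcd
      simpa only [map_mul, hw, hw'] using this
    apply hdc
    have : w * w' ≠ 0 := mul_ne_zero hw0 hw0'
    apply mul_left_cancel₀ this
    linear_combination w * d * hcd' - w * σ d * hcd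
  · have key := difference_identity (a₀ := a) (a₁ := σ a) (a₂ := σ (σ a)) (b₀ := b) (b₁ := σ b)
      (b₂ := σ (σ b)) (by linear_combination e1) (by linear_combination e2)
    rcases mul_eq_zero.1 key with hk | hk
    · rcases mul_eq_zero.1 hk with hk | hk
      · apply ha
        have : a = 1 := (sub_eq_zero.1 hk).symm
        simp [this]
      · rcases mul_eq_zero.1 hk with hk | hk
        · exact ha (sub_eq_zero.1 hk).symm
        · exact ha (map_map_eq_self_iff hσ (sub_eq_zero.1 hk).symm)
    · rcases mul_eq_zero.1 hk with hk | hk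
      · apply h₁
        apply σ.injective
        simp only [map_mul, map_sub, map_one]
        linear_combination hk
      · apply h₀
        apply σ.injective
        simp only [map_mul, map_sub, map_one]
        linear_combination hk

end Core

/-! ### Points of a cubic extension as vectors of an eight-dimensional space -/

/-- A cyclic cubic extension, with a generator of its Galois group and its norm. -/
structure CubicData (F K : Type*) [Field F] [Field K] [Algebra F K] where
  σ : K →ₐ[F] K
  cube : ∀ x, σ (σ (σ x)) = x
  fixed : ∀ x, σ x = x → ∃ r : F, algebraMap F K r = x
  nm : K → F
  nm_eq : ∀ x, algebraMap F K (nm x) = x * σ x * σ (σ x)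

namespace CubicData

variable {F K : Type*} [Field F] [Field K] [Algebra F K] (D : CubicData F K)

/-- The point of the eight-dimensional space that represents `z`: a function of `z` is multi-affine in
the conjugates of `z` if and only if it is linear in `D.vec z`. -/
def vec (z : K) : F × K × K × F := (1, z, adj (D.σ : K →+* K) z, D.nm z)

/-- Four points of `K` lie on a circle. -/
def Conc (a b c d : K) : Prop := Concyclic (D.σ : K →+* K) a b c d

variable {D}

theorem cube' : ∀ x, (D.σ : K →+* K) ((D.σ : K →+* K) ((D.σ : K →+* K) x)) = x := D.cube

/-- The coordinates of `D.vec` and their conjugates are all eight squarefree monomials in `z`, `σ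
z`, `σ (σ z)`. The scalars `l i` lie in `F`, so a relation between the vectors can be conjugated. -/
theorem sum_multiaffine {ι : Type*} [Fintype ι] {l : ι → F} {z : ι → K}
    (h : ∑ i, l i • D.vec (z i) = 0) (p q r : K) :
    ∑ i, algebraMap F K (l i) * ((z i - p) * (D.σ (z i) - q) * (D.σ (D.σ (z i)) - r)) = 0 := by
  have h0 : ∑ i, l i = 0 := by
    have := congrArg Prod.fst h
    simpa [vec, Prod.fst_sum] using this
  have h1 : ∑ i, algebraMap F K (l i) * z i = 0 := by
    have := congrArg (fun t => t.2.1) h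
    simpa [vec, Prod.fst_sum, Prod.snd_sum, Algebra.smul_def] using this
  have h2 : ∑ i, algebraMap F K (l i) * (D.σ (z i) * D.σ (D.σ (z i))) = 0 := by
    have := congrArg (fun t => t.2.2.1) h
    simpa [vec, adj, Prod.fst_sum, Prod.snd_sum, Algebra.smul_def] using this
  have h3 : ∑ i, algebraMap F K (l i) * (z i * D.σ (z i) * D.σ (D.σ (z i))) = 0 := by
    have := congrArg (fun t => algebraMap F K t.2.2.2) h
    simpa [vec, Prod.fst_sum, Prod.snd_sum, D.nm_eq] using this
  have h0' : ∑ i, algebraMap F K (l i) = 0 := by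
    rw [← map_sum, h0, map_zero]
  have h1' := congrArg D.σ h1
  have h1'' := congrArg D.σ h1'
  have h2' := congrArg D.σ h2
  have h2'' := congrArg D.σ h2'
  simp only [map_sum, map_mul, AlgHom.commutes, map_zero, D.cube] at h1' h1'' h2' h2''
  have : ∀ i, algebraMap F K (l i) * ((z i - p) * (D.σ (z i) - q) * (D.σ (D.σ (z i)) - r)) =
      algebraMap F K (l i) * (z i * D.σ (z i) * D.σ (D.σ (z i)))
      - p * (algebraMap F K (l i) * (D.σ (z i) * D.σ (D.σ (z i))))
      - q * (algebraMap F K (l i) * (D.σ (D.σ (z i)) * z i))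
      - r * (algebraMap F K (l i) * (z i * D.σ (z i)))
      + q * r * (algebraMap F K (l i) * z i)
      + p * r * (algebraMap F K (l i) * D.σ (z i))
      + p * q * (algebraMap F K (l i) * D.σ (D.σ (z i)))
      - p * q * r * algebraMap F K (l i) := fun i => by ring
  simp only [this, Finset.sum_add_distrib, Finset.sum_sub_distrib, ← Finset.mul_sum, h0', h1, h1',
    h1'', h2, h2', h2'', h3]
  ring

theorem fixed_cross_iff {σ : K →+* K} {u v u' v' : K} (hv : v ≠ 0) (hv' : v' ≠ 0)
    (h : u * v' = u' * v) : u * σ v = σ u * v ↔ u' * σ v' = σ u' * v' := by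
  rw [← div_fixed_iff hv, ← div_fixed_iff hv', (div_eq_div_iff hv hv').2 h]

theorem conc_iff {a b c d : K} : D.Conc a b c d ↔
    (d - a) * (b - c) * (D.σ : K →+* K) ((d - c) * (b - a)) =
      (D.σ : K →+* K) ((d - a) * (b - c)) * ((d - c) * (b - a)) := by
  unfold Conc Concyclic
  exact eq_comm

theorem nm_ne_zero {x : K} (hx : x ≠ 0) : algebraMap F K (D.nm x) ≠ 0 := by
  rw [D.nm_eq]
  have h1 : D.σ x ≠ 0 := (map_ne_zero _).2 hx
  exact mul_ne_zero (mul_ne_zero hx h1) ((map_ne_zero _).2 h1)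

theorem algebraMap_fixed (r : F) : (D.σ : K →+* K) (algebraMap F K r) = algebraMap F K r :=
  D.σ.commutes r

/-- The coordinate for which `p` and `q` are at infinity and at zero. -/
def ratio (p q z : K) : K := (z - q) / (z - p)

theorem ratio_cross_iff {p q z w : K} (hzp : z ≠ p) (hzq : z ≠ q) (hwp : w ≠ p)
    (hwq : w ≠ q) : ratio p q w * (D.σ : K →+* K) (ratio p q z) =
      (D.σ : K →+* K) (ratio p q w) * ratio p q z ↔ D.Conc q z p w := by
  rw [conc_iff]
  have e1 := sub_ne_zero.2 hzp
  have e2 := sub_ne_zero.2 hzq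
  have e3 := sub_ne_zero.2 hwp
  have e4 := sub_ne_zero.2 hwq
  apply fixed_cross_iff
  · exact div_ne_zero e2 e1
  · exact mul_ne_zero e3 e2
  · unfold ratio
    field_simp

/-- In the coordinate with `p` at infinity, `q` at 0 and `z₂` at 1, the first five vectors are
independent, so the dependence expresses the sixth point and its `adj` with common coefficients. -/
theorem six_points {p q z₂ z₃ z₄ z₅ : K} (hpq : p ≠ q)
    (h2p : z₂ ≠ p) (h2q : z₂ ≠ q) (h3p : z₃ ≠ p) (h3q : z₃ ≠ q) (h4p : z₄ ≠ p) (h4q : z₄ ≠ q)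
    (h5p : z₅ ≠ p) (h34 : z₃ ≠ z₄)
    (c23 : ¬ D.Conc q z₂ p z₃) (c24 : ¬ D.Conc q z₂ p z₄)
    (hdep : ¬ LinearIndependent F (fun i => D.vec (![p, q, z₂, z₃, z₄, z₅] i))) :
    ∃ x y w : K, D.σ x = x ∧ D.σ y = y ∧ D.σ w = w ∧
      ratio p q z₅ / ratio p q z₂ =
        x + y * (ratio p q z₃ / ratio p q z₂) + w * (ratio p q z₄ / ratio p q z₂) ∧
      adj (D.σ : K →+* K) (ratio p q z₅ / ratio p q z₂) =
        x + y * adj (D.σ : K →+* K) (ratio p q z₃ / ratio p q z₂) +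
          w * adj (D.σ : K →+* K) (ratio p q z₄ / ratio p q z₂) := by
  rw [Fintype.not_linearIndependent_iff] at hdep
  obtain ⟨l, hl, i₀, hi₀⟩ := hdep
  have mul_ratio : ∀ z, z ≠ p → algebraMap F K (D.nm (z - p)) * ratio p q z =
      (z - q) * (D.σ z - D.σ p) * (D.σ (D.σ z) - D.σ (D.σ p)) := by
    intro z hz
    rw [D.nm_eq, ratio]
    have := sub_ne_zero.2 hz
    field_simp
    simp only [map_sub]
    ring
  have mul_adj : ∀ z, z ≠ p → algebraMap F K (D.nm (z - p)) * adj (D.σ : K →+* K) (ratio p q z) =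
      (z - p) * (D.σ z - D.σ q) * (D.σ (D.σ z) - D.σ (D.σ q)) := by
    intro z hz
    rw [D.nm_eq, ratio, adj_div]
    have h0 := sub_ne_zero.2 hz
    have h1 : D.σ (z - p) ≠ 0 := (map_ne_zero _).2 h0
    have h2 : D.σ (D.σ (z - p)) ≠ 0 := (map_ne_zero _).2 h1
    simp only [adj, RingHom.coe_coe]
    field_simp
    simp only [map_sub]
  -- Both multi-affine functions vanish at `p` and at `q`. On the other points they are `ratio p q`
  -- and its `adj`, up to the norm of `z - p`.
  have r1 := sum_multiaffine hl q (D.σ p) (D.σ (D.σ p))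
  have r2 := sum_multiaffine hl p (D.σ q) (D.σ (D.σ q))
  simp only [Fin.sum_univ_six, Matrix.cons_val_zero, Matrix.cons_val_one, Matrix.cons_val,
    sub_self, zero_mul, mul_zero, zero_add] at r1 r2
  rw [← mul_ratio _ h2p, ← mul_ratio _ h3p, ← mul_ratio _ h4p, ← mul_ratio _ h5p] at r1
  rw [← mul_adj _ h2p, ← mul_adj _ h3p, ← mul_adj _ h4p, ← mul_adj _ h5p] at r2
  have n2 := D.nm_ne_zero (sub_ne_zero.2 h2p)
  have n3 := D.nm_ne_zero (sub_ne_zero.2 h3p)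
  have n4 := D.nm_ne_zero (sub_ne_zero.2 h4p)
  have n5 := D.nm_ne_zero (sub_ne_zero.2 h5p)
  have y2 : ratio p q z₂ ≠ 0 := div_ne_zero (sub_ne_zero.2 h2q) (sub_ne_zero.2 h2p)
  have y34 : ratio p q z₃ ≠ ratio p q z₄ := by
    unfold ratio
    rw [Ne, div_eq_div_iff (sub_ne_zero.2 h3p) (sub_ne_zero.2 h4p)]
    intro hh
    have : (z₃ - z₄) * (q - p) = 0 := by linear_combination hh
    rcases mul_eq_zero.1 this with h | h
    · exact h34 (sub_eq_zero.1 h)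
    · exact hpq (sub_eq_zero.1 h).symm
  by_cases hl5 : l 5 = 0
  · exfalso
    rw [hl5] at r1 r2
    simp only [map_zero, zero_mul, add_zero, ← mul_assoc, ← map_mul] at r1 r2
    obtain ⟨e2, e3, e4⟩ := adj_triple_independent_ratio (σ := (D.σ : K →+* K)) cube'
      (algebraMap_fixed _) (algebraMap_fixed _) (algebraMap_fixed _)
      (fun h => c23 ((ratio_cross_iff h2p h2q h3p h3q).1 h))
      (fun h => c24 ((ratio_cross_iff h2p h2q h4p h4q).1 h)) y34 r1 r2
    simp only [map_mul, mul_eq_zero, n2, n3, n4, or_false, map_eq_zero] at e2 e3 e4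
    -- Only `p` and `q` remain; the norms of `z - q` and `z - p` separate them.
    have r3 := sum_multiaffine hl q (D.σ q) (D.σ (D.σ q))
    have r4 := sum_multiaffine hl p (D.σ p) (D.σ (D.σ p))
    simp only [Fin.sum_univ_six, Matrix.cons_val_zero, Matrix.cons_val_one, Matrix.cons_val,
      sub_self, zero_mul, mul_zero, zero_add, e2, e3, e4, hl5, map_zero, add_zero] at r3 r4
    simp only [← map_sub, ← D.nm_eq, mul_eq_zero, map_eq_zero] at r3 r4
    have n0 := D.nm_ne_zero (sub_ne_zero.2 hpq)
    have n1 := D.nm_ne_zero (sub_ne_zero.2 hpq.symm)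
    rw [map_ne_zero] at n0 n1
    have e0 := r3.resolve_right n0
    have e1 := r4.resolve_right n1
    apply hi₀
    fin_cases i₀
    · exact e0
    · exact e1
    · exact e2
    · exact e3
    · exact e4
    · exact hl5
  · set m : Fin 6 → F → F := fun i n => - (l i * n) / (l 5 * D.nm (z₅ - p)) with hm
    have l5 : algebraMap F K (l 5) ≠ 0 := by simpa using hl5
    have ha2 : adj (D.σ : K →+* K) (ratio p q z₂) ≠ 0 := by simp [adj, y2]
    refine ⟨algebraMap F K (m 2 (D.nm (z₂ - p))), algebraMap F K (m 3 (D.nm (z₃ - p))),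
      algebraMap F K (m 4 (D.nm (z₄ - p))), D.σ.commutes _, D.σ.commutes _, D.σ.commutes _, ?_, ?_⟩
    · simp only [hm, map_div₀, map_neg, map_mul]
      field_simp
      linear_combination r1
    · simp only [adj_div, hm, map_div₀, map_neg, map_mul]
      field_simp
      linear_combination r2

end CubicData

/-! ### Seven points, and the independence of few points -/

namespace CubicData

variable {F K : Type*} [Field F] [Field K] [Algebra F K] {D : CubicData F K}

theorem ratio_sub {p q z w : K} (hz : z ≠ p) (hw : w ≠ p) :
    ratio p q z - ratio p q w = (z - w) * (q - p) / ((z - p) * (w - p)) := by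
  have := sub_ne_zero.2 hz
  have := sub_ne_zero.2 hw
  unfold ratio
  field_simp
  ring

/-- Seven points that span a space of dimension at most five are not in general position. -/
theorem exists_concyclic {z : Fin 7 → K} (hz : Function.Injective z)
    (hdep : ∀ g : Fin 6 → Fin 7, ¬ LinearIndependent F (fun i => D.vec (z (g i)))) :
    ∃ i j k l : Fin 7, i ≠ j ∧ i ≠ k ∧ i ≠ l ∧ j ≠ k ∧ j ≠ l ∧ k ≠ l ∧
      D.Conc (z i) (z j) (z k) (z l) := by
  by_contra hcon
  have nc : ∀ i j k l : Fin 7, i ≠ j → i ≠ k → i ≠ l → j ≠ k → j ≠ l → k ≠ l →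
      ¬ D.Conc (z i) (z j) (z k) (z l) := fun i j k l h1 h2 h3 h4 h5 h6 h =>
    hcon ⟨i, j, k, l, h1, h2, h3, h4, h5, h6, h⟩
  have ne : ∀ i j : Fin 7, i ≠ j → z i ≠ z j := fun i j h h' => h (hz h')
  have rat_fix : ∀ i j : Fin 7, i ≠ 0 → i ≠ 1 → j ≠ 0 → j ≠ 1 → i ≠ j →
      ratio (z 0) (z 1) (z j) * (D.σ : K →+* K) (ratio (z 0) (z 1) (z i)) ≠
      (D.σ : K →+* K) (ratio (z 0) (z 1) (z j)) * ratio (z 0) (z 1) (z i) := by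
    intro i j hi0 hi1 hj0 hj1 hij h
    exact nc 1 i 0 j hi1.symm (by decide) hj1.symm hi0 hij hj0.symm
      ((ratio_cross_iff (ne _ _ hi0) (ne _ _ hi1) (ne _ _ hj0) (ne _ _ hj1)).1 h)
  have rat0 : ∀ i : Fin 7, i ≠ 0 → i ≠ 1 → ratio (z 0) (z 1) (z i) ≠ 0 := fun i h0 h1 =>
    div_ne_zero (sub_ne_zero.2 (ne _ _ h1)) (sub_ne_zero.2 (ne _ _ h0))
  have rat_inj : ∀ i j : Fin 7, i ≠ 0 → j ≠ 0 → i ≠ j →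
      ratio (z 0) (z 1) (z i) ≠ ratio (z 0) (z 1) (z j) := by
    intro i j hi hj hij h
    rw [← sub_eq_zero, ratio_sub (ne _ _ hi) (ne _ _ hj)] at h
    have e1 := sub_ne_zero.2 (ne _ _ hi)
    have e2 := sub_ne_zero.2 (ne _ _ hj)
    have e3 := sub_ne_zero.2 (ne _ _ hij)
    have e4 := sub_ne_zero.2 (ne 1 0 (by decide))
    exact div_ne_zero (mul_ne_zero e3 e4) (mul_ne_zero e1 e2) h
  -- The points 0, 1, 2 are sent to infinity, 0, 1. The points 3 and 4 become `a` and `b`, and 5 and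
  -- 6 the two extra points of `not_two_extra_points`.
  obtain ⟨x, y, w, hx, hy, hw, h5, h5'⟩ := six_points (D := D) (p := z 0) (q := z 1) (z₂ := z 2)
    (z₃ := z 3) (z₄ := z 4) (z₅ := z 5) (ne _ _ (by decide)) (ne _ _ (by decide))
    (ne _ _ (by decide)) (ne _ _ (by decide)) (ne _ _ (by decide)) (ne _ _ (by decide))
    (ne _ _ (by decide)) (ne _ _ (by decide)) (ne _ _ (by decide))
    (nc _ _ _ _ (by decide) (by decide) (by decide) (by decide) (by decide) (by decide))
    (nc _ _ _ _ (by decide) (by decide) (by decide) (by decide) (by decide) (by decide))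
    (by
      convert hdep ![0, 1, 2, 3, 4, 5] using 4 with i
      fin_cases i <;> rfl)
  obtain ⟨x', y', w', hx', hy', hw', h6, h6'⟩ := six_points (D := D) (p := z 0) (q := z 1)
    (z₂ := z 2) (z₃ := z 3) (z₄ := z 4) (z₅ := z 6) (ne _ _ (by decide)) (ne _ _ (by decide))
    (ne _ _ (by decide)) (ne _ _ (by decide)) (ne _ _ (by decide)) (ne _ _ (by decide))
    (ne _ _ (by decide)) (ne _ _ (by decide)) (ne _ _ (by decide))
    (nc _ _ _ _ (by decide) (by decide) (by decide) (by decide) (by decide) (by decide))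
    (nc _ _ _ _ (by decide) (by decide) (by decide) (by decide) (by decide) (by decide))
    (by
      convert hdep ![0, 1, 2, 3, 4, 6] using 4 with i
      fin_cases i <;> rfl)
  set y2 := ratio (z 0) (z 1) (z 2) with hy2
  have y20 : y2 ≠ 0 := rat0 2 (by decide) (by decide)
  have fix1 : ∀ j : Fin 7, j ≠ 0 → j ≠ 1 → j ≠ 2 →
      (D.σ : K →+* K) (ratio (z 0) (z 1) (z j) / y2) ≠ ratio (z 0) (z 1) (z j) / y2 := by
    intro j h0 h1 h2 h
    exact rat_fix 2 j (by decide) (by decide) h0 h1 h2.symm ((div_fixed_iff y20).1 h)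
  have fix2 : ∀ i j : Fin 7, i ≠ 0 → i ≠ 1 → j ≠ 0 → j ≠ 1 → i ≠ j →
      ratio (z 0) (z 1) (z j) / y2 * (D.σ : K →+* K) (ratio (z 0) (z 1) (z i) / y2) ≠
      (D.σ : K →+* K) (ratio (z 0) (z 1) (z j) / y2) * (ratio (z 0) (z 1) (z i) / y2) := by
    intro i j hi0 hi1 hj0 hj1 hij
    rw [Ne, fixed_cross_iff (σ := (D.σ : K →+* K)) (u' := ratio (z 0) (z 1) (z j))
      (v' := ratio (z 0) (z 1) (z i)) (div_ne_zero (rat0 i hi0 hi1) y20) (rat0 i hi0 hi1)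
      (by ring)]
    exact rat_fix i j hi0 hi1 hj0 hj1 hij
  have inj2 : ∀ i j : Fin 7, i ≠ 0 → j ≠ 0 → i ≠ j →
      ratio (z 0) (z 1) (z i) / y2 ≠ ratio (z 0) (z 1) (z j) / y2 := by
    intro i j hi hj hij h
    exact rat_inj i j hi hj hij ((div_left_inj' y20).1 h)
  have s20 := sub_ne_zero.2 (ne 2 0 (by decide))
  have s21 := sub_ne_zero.2 (ne 2 1 (by decide))
  have s30 := sub_ne_zero.2 (ne 3 0 (by decide))
  have s31 := sub_ne_zero.2 (ne 3 1 (by decide))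
  have s40 := sub_ne_zero.2 (ne 4 0 (by decide))
  have s41 := sub_ne_zero.2 (ne 4 1 (by decide))
  have s10 := sub_ne_zero.2 (ne 1 0 (by decide))
  have s32 := sub_ne_zero.2 (ne 3 2 (by decide))
  have y40 := rat0 4 (by decide) (by decide)
  have d32 : ratio (z 0) (z 1) (z 3) - y2 =
      (z 3 - z 2) * (z 1 - z 0) / ((z 3 - z 0) * (z 2 - z 0)) :=
    ratio_sub (ne _ _ (by decide)) (ne _ _ (by decide))
  have d42 : ratio (z 0) (z 1) (z 4) - y2 =
      (z 4 - z 2) * (z 1 - z 0) / ((z 4 - z 0) * (z 2 - z 0)) :=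
    ratio_sub (ne _ _ (by decide)) (ne _ _ (by decide))
  have d32' : ratio (z 0) (z 1) (z 3) - y2 ≠ 0 :=
    sub_ne_zero.2 (rat_inj 3 2 (by decide) (by decide) (by decide))
  have a1 : ratio (z 0) (z 1) (z 3) / y2 - 1 = (ratio (z 0) (z 1) (z 3) - y2) / y2 := by
    field_simp
  have b1 : ratio (z 0) (z 1) (z 4) / y2 - 1 = (ratio (z 0) (z 1) (z 4) - y2) / y2 := by
    field_simp
  refine not_two_extra_points (σ := (D.σ : K →+* K)) cube' hx hy hw hx' hy' hw'
    (fix1 3 (by decide) (by decide) (by decide)) (fix1 4 (by decide) (by decide) (by decide))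
    (fix1 5 (by decide) (by decide) (by decide)) (fix1 6 (by decide) (by decide) (by decide))
    (inj2 _ _ (by decide) (by decide) (by decide)) (inj2 _ _ (by decide) (by decide) (by decide))
    (inj2 _ _ (by decide) (by decide) (by decide)) (inj2 _ _ (by decide) (by decide) (by decide))
    (fix2 _ _ (by decide) (by decide) (by decide) (by decide) (by decide))
    (fix2 _ _ (by decide) (by decide) (by decide) (by decide) (by decide))
    (fix2 _ _ (by decide) (by decide) (by decide) (by decide) (by decide))
    (fix2 _ _ (by decide) (by decide) (by decide) (by decide) (by decide))
    ?_ ?_ h5 h5' h6 h6'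
  · intro h
    refine nc 2 3 0 4 (by decide) (by decide) (by decide) (by decide) (by decide) (by decide)
      (conc_iff.2 ((fixed_cross_iff ?_ ?_ ?_).1 h))
    · rw [a1]; exact div_ne_zero d32' y20
    · exact mul_ne_zero s40 s32
    · rw [a1, b1, d32, d42]
      field_simp
  · intro h
    refine nc 2 3 1 4 (by decide) (by decide) (by decide) (by decide) (by decide) (by decide)
      (conc_iff.2 ((fixed_cross_iff ?_ ?_ ?_).1 h))
    · refine mul_ne_zero (div_ne_zero y40 y20) ?_
      rw [← neg_sub, a1]; exact neg_ne_zero.2 (div_ne_zero d32' y20)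
    · exact mul_ne_zero s41 s32
    · rw [← neg_sub, ← neg_sub (ratio (z 0) (z 1) (z 3) / y2) 1, a1, b1, d32, d42]
      simp only [hy2, ratio]
      field_simp

theorem linearIndependent_two {a b : K} (hab : a ≠ b) :
    LinearIndependent F (fun i => D.vec (![a, b] i)) := by
  rw [Fintype.linearIndependent_iff]
  intro l hl
  have ab := sub_ne_zero.2 hab
  have ba := sub_ne_zero.2 hab.symm
  have r1 := sum_multiaffine hl a (D.σ a) (D.σ (D.σ a))
  have r2 := sum_multiaffine hl b (D.σ b) (D.σ (D.σ b))
  simp [Fin.sum_univ_two, ← map_sub, ab, ba] at r1 r2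
  intro i
  fin_cases i
  · exact r2
  · exact r1

/-- A multi-affine function has three factors, which can be made to vanish at any three of the
points and not at the fourth. -/
theorem linearIndependent_four {a b c d : K} (hab : a ≠ b) (hac : a ≠ c) (had : a ≠ d)
    (hbc : b ≠ c) (hbd : b ≠ d) (hcd : c ≠ d) :
    LinearIndependent F (fun i => D.vec (![a, b, c, d] i)) := by
  rw [Fintype.linearIndependent_iff]
  intro l hl
  have ab := sub_ne_zero.2 hab
  have ac := sub_ne_zero.2 hac
  have da := sub_ne_zero.2 had.symm
  have ad := sub_ne_zero.2 had
  have ba := sub_ne_zero.2 hab.symm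
  have bc := sub_ne_zero.2 hbc
  have bd := sub_ne_zero.2 hbd
  have db := sub_ne_zero.2 hbd.symm
  have ca := sub_ne_zero.2 hac.symm
  have cb := sub_ne_zero.2 hbc.symm
  have cd := sub_ne_zero.2 hcd
  have dc := sub_ne_zero.2 hcd.symm
  have r1 := sum_multiaffine hl a (D.σ b) (D.σ (D.σ c))
  have r2 := sum_multiaffine hl a (D.σ b) (D.σ (D.σ d))
  have r3 := sum_multiaffine hl a (D.σ c) (D.σ (D.σ d))
  have r4 := sum_multiaffine hl b (D.σ c) (D.σ (D.σ d))
  simp [Fin.sum_univ_four, ← map_sub, *] at r1 r2 r3 r4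
  intro i
  fin_cases i
  · exact r4
  · exact r3
  · exact r2
  · exact r1

/-- Two multi-affine functions vanishing at `a`, `b`, `c` leave two relations between the
coefficients of `d` and `e`. If that of `e` were nonzero, elimination would make the cross ratio of
`a`, `c`, `d`, `e` fixed, and `e` would lie on the circle. -/
theorem linearIndependent_five {a b c d e : K} (hab : a ≠ b) (hac : a ≠ c) (had : a ≠ d)
    (hbc : b ≠ c) (hbd : b ≠ d) (hcd : c ≠ d) (hec : e ≠ c)
    (h : D.Conc a b c d) (h' : ¬ D.Conc a b c e) :
    LinearIndependent F (fun i => D.vec (![a, b, c, d, e] i)) := by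
  have hea : e ≠ a := by
    rintro rfl
    exact h' (by simp [Conc, Concyclic])
  have heb : e ≠ b := by
    rintro rfl
    exact h' (by simp only [Conc, Concyclic]; ring_nf)
  rw [Fintype.linearIndependent_iff]
  intro l hl
  have ba := sub_ne_zero.2 hab.symm
  have da := sub_ne_zero.2 had.symm
  have db := sub_ne_zero.2 hbd.symm
  have dc := sub_ne_zero.2 hcd.symm
  have ec := sub_ne_zero.2 hec
  have ea := sub_ne_zero.2 hea
  have eb := sub_ne_zero.2 heb
  have r1 := sum_multiaffine hl a (D.σ c) (D.σ (D.σ b))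
  have r2 := sum_multiaffine hl c (D.σ a) (D.σ (D.σ b))
  simp only [Fin.sum_univ_five, Matrix.cons_val_zero, Matrix.cons_val_one, Matrix.cons_val,
    sub_self, zero_mul, mul_zero, zero_add, ← map_sub, map_zero] at r1 r2
  have l4 : l 4 = 0 := by
    by_contra hl4
    apply h'
    have hl4' : algebraMap F K (l 4) ≠ 0 := by simpa using hl4
    have key : (e - a) * (d - c) * (D.σ : K →+* K) ((e - c) * (d - a)) =
        (D.σ : K →+* K) ((e - a) * (d - c)) * ((e - c) * (d - a)) := by
      have e1 : D.σ (D.σ (e - b)) ≠ 0 := (map_ne_zero _).2 ((map_ne_zero _).2 eb)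
      have e2 : D.σ (D.σ (d - b)) ≠ 0 := (map_ne_zero _).2 ((map_ne_zero _).2 db)
      apply mul_left_cancel₀ (mul_ne_zero hl4' (mul_ne_zero e1 e2))
      simp only [map_mul, RingHom.coe_coe]
      linear_combination (d - c) * D.σ (d - a) * D.σ (D.σ (d - b)) * r1 -
        (d - a) * D.σ (d - c) * D.σ (D.σ (d - b)) * r2
    have key2 := conc_iff.1 h
    rw [conc_iff]
    refine (fixed_cross_iff (u := (e - a) * (d - c) * ((d - a) * (b - c)))
      (v := (e - c) * (d - a) * ((d - c) * (b - a))) ?_ (mul_ne_zero ec ba) (by ring)).1 ?_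
    · exact mul_ne_zero (mul_ne_zero ec da) (mul_ne_zero dc ba)
    · rw [map_mul _ ((e - c) * (d - a)), map_mul _ ((e - a) * (d - c))]
      linear_combination ((d - a) * (b - c) * (D.σ : K →+* K) ((d - c) * (b - a))) * key +
        ((D.σ : K →+* K) ((e - a) * (d - c)) * ((e - c) * (d - a))) * key2
  have h4 := linearIndependent_four (D := D) hab hac had hbc hbd hcd
  rw [Fintype.linearIndependent_iff] at h4
  have h5 := h4 ![l 0, l 1, l 2, l 3] (by
    simpa [Fin.sum_univ_five, Fin.sum_univ_four, l4] using hl)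
  intro i
  fin_cases i
  · exact h5 0
  · exact h5 1
  · exact h5 2
  · exact h5 3
  · exact l4

/-! ### Circles as twisted cubics -/

section Circle

variable (D)

/-- The homogeneous form of `D.vec`. -/
def hvec (n d : K) : F × K × K × F :=
  (D.nm d, n * adj (D.σ : K →+* K) d, adj (D.σ : K →+* K) n * d, D.nm n)

variable {D}

theorem nm_mul (x y : K) : D.nm (x * y) = D.nm x * D.nm y := by
  apply (algebraMap F K).injective
  rw [map_mul, D.nm_eq, D.nm_eq, D.nm_eq]
  simp only [map_mul]
  ring

theorem hvec_mul (z d : K) : D.hvec (z * d) d = D.nm d • D.vec z := by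
  simp only [hvec, vec, nm_mul, Prod.smul_mk, smul_eq_mul, mul_one, Prod.mk.injEq, true_and]
  simp only [Algebra.smul_def, D.nm_eq, adj, RingHom.coe_coe, map_mul]
  refine ⟨by ring, by ring, by ring⟩

theorem exists_nm_expansion (x y : K) :
    ∃ c₁ c₂ : F, ∀ s : F, D.nm (x + s • y) = D.nm x + s * c₁ + s ^ 2 * c₂ + s ^ 3 * D.nm y := by
  obtain ⟨c₁, h1⟩ := D.fixed (y * D.σ x * D.σ (D.σ x) + x * D.σ y * D.σ (D.σ x) +
    x * D.σ x * D.σ (D.σ y)) (by simp only [map_add, map_mul, D.cube]; ring)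
  obtain ⟨c₂, h2⟩ := D.fixed (x * D.σ y * D.σ (D.σ y) + y * D.σ x * D.σ (D.σ y) +
    y * D.σ y * D.σ (D.σ x)) (by simp only [map_add, map_mul, D.cube]; ring)
  refine ⟨c₁, c₂, fun s => ?_⟩
  apply (algebraMap F K).injective
  simp only [map_add, map_mul, map_pow, D.nm_eq, h1, h2, Algebra.smul_def, AlgHom.commutes]
  ring

theorem exists_hvec_expansion (n₀ n₁ d₀ d₁ : K) : ∃ E₁ E₂ : F × K × K × F, ∀ s : F,
    D.hvec (n₀ + s • n₁) (d₀ + s • d₁) =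
      D.hvec n₀ d₀ + s • E₁ + s ^ 2 • E₂ + s ^ 3 • D.hvec n₁ d₁ := by
  obtain ⟨a₁, a₂, ha⟩ := exists_nm_expansion (D := D) n₀ n₁
  obtain ⟨b₁, b₂, hb⟩ := exists_nm_expansion (D := D) d₀ d₁
  refine ⟨(b₁, n₁ * D.σ d₀ * D.σ (D.σ d₀) + n₀ * (D.σ d₁ * D.σ (D.σ d₀) + D.σ d₀ * D.σ (D.σ d₁)),
      d₁ * D.σ n₀ * D.σ (D.σ n₀) + d₀ * (D.σ n₁ * D.σ (D.σ n₀) + D.σ n₀ * D.σ (D.σ n₁)), a₁),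
    (b₂, n₀ * D.σ d₁ * D.σ (D.σ d₁) + n₁ * (D.σ d₁ * D.σ (D.σ d₀) + D.σ d₀ * D.σ (D.σ d₁)),
      d₀ * D.σ n₁ * D.σ (D.σ n₁) + d₁ * (D.σ n₁ * D.σ (D.σ n₀) + D.σ n₀ * D.σ (D.σ n₁)), a₂),
    fun s => ?_⟩
  simp only [hvec, ha, hb, Prod.smul_mk, smul_eq_mul, Prod.mk_add_mk, Prod.mk.injEq, true_and,
    and_true]
  simp only [Algebra.smul_def, adj, map_add, map_mul, map_pow, RingHom.coe_coe, AlgHom.commutes]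
  refine ⟨by ring, by ring⟩

/-- The parametrization of the circle through `a`, `b`, `c`: numerator and denominator. -/
theorem exists_param {a b c e : K} (hab : a ≠ b) (hac : a ≠ c) (hbc : b ≠ c) (hec : e ≠ c)
    (h : D.Conc a b c e) : ∃ s : F, (b - c) + s • (-(b - a)) ≠ 0 ∧
      a * (b - c) + s • (-(c * (b - a))) = e * ((b - c) + s • (-(b - a))) ∧
      (s = 0 → e = a) ∧ (s = 1 → e = b) := by
  have hY : (e - c) * (b - a) ≠ 0 := mul_ne_zero (sub_ne_zero.2 hec) (sub_ne_zero.2 hab.symm)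
  obtain ⟨s, hs⟩ := D.fixed ((e - a) * (b - c) / ((e - c) * (b - a)))
    ((div_fixed_iff (σ := (D.σ : K →+* K)) hY).2 (conc_iff.1 h))
  rw [eq_div_iff hY] at hs
  have hn : a * (b - c) + s • (-(c * (b - a))) = e * ((b - c) + s • (-(b - a))) := by
    simp only [Algebra.smul_def]
    linear_combination hs
  have hd : (b - c) + s • (-(b - a)) ≠ 0 := by
    intro h0
    have h1 := hn
    rw [h0, mul_zero] at h1
    simp only [Algebra.smul_def] at h0 h1
    have : (a - c) * (b - c) = 0 := by linear_combination h1 - c * h0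
    rcases mul_eq_zero.1 this with h | h
    · exact hac (sub_eq_zero.1 h)
    · exact hbc (sub_eq_zero.1 h)
  refine ⟨s, hd, hn, ?_, ?_⟩
  · rintro rfl
    simp only [zero_smul, add_zero] at hn
    exact (mul_right_cancel₀ (sub_ne_zero.2 hbc) hn).symm
  · rintro rfl
    simp only [one_smul] at hn
    have : (e - b) * (a - c) = 0 := by linear_combination -hn
    rcases mul_eq_zero.1 this with h | h
    · exact sub_eq_zero.1 h
    · exact absurd (sub_eq_zero.1 h) hac

/-- A linear form that vanishes at four points of a circle vanishes on the circle. -/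
theorem eq_zero_on_circle {a b c d : K} (hab : a ≠ b) (hac : a ≠ c) (had : a ≠ d)
    (hbc : b ≠ c) (hbd : b ≠ d) (hcd : c ≠ d) (h : D.Conc a b c d)
    {f : F × K × K × F →ₗ[F] F} (ha : f (D.vec a) = 0) (hb : f (D.vec b) = 0)
    (hc : f (D.vec c) = 0) (hd : f (D.vec d) = 0) (s : F) :
    f (D.hvec (a * (b - c) + s • (-(c * (b - a)))) ((b - c) + s • (-(b - a)))) = 0 := by
  obtain ⟨E₁, E₂, hE⟩ := exists_hvec_expansion (D := D) (a * (b - c)) (-(c * (b - a))) (b - c)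
    (-(b - a))
  obtain ⟨r, hr, hr', hr0, hr1⟩ := exists_param hab hac hbc hcd.symm h
  have e0 : f (D.hvec (a * (b - c)) (b - c)) = 0 := by rw [hvec_mul, map_smul, ha, smul_zero]
  have e3 : f (D.hvec (-(c * (b - a))) (-(b - a))) = 0 := by
    rw [← mul_neg, hvec_mul, map_smul, hc, smul_zero]
  -- Along the circle `f` is a cubic polynomial in the parameter. The points `a` (parameter 0) and
  -- `c` (infinity) kill the extreme coefficients; `b` (parameter 1) and `d` (parameter `r`) then
  -- kill the other two.
  have hf : ∀ s : F, f (D.hvec (a * (b - c) + s • (-(c * (b - a)))) ((b - c) + s • (-(b - a)))) =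
      s * f E₁ + s ^ 2 * f E₂ := by
    intro s
    rw [hE, map_add, map_add, map_add, map_smul, map_smul, map_smul, e0, e3]
    simp
  have f1 : f E₁ + f E₂ = 0 := by
    have h1 := hf 1
    have : a * (b - c) + (1 : F) • (-(c * (b - a))) = b * ((b - c) + (1 : F) • (-(b - a))) := by
      simp only [one_smul]; ring
    rw [this, hvec_mul, map_smul, hb, smul_zero] at h1
    linear_combination -h1
  have f2 := hf r
  rw [hr', hvec_mul, map_smul, hd, smul_zero] at f2
  have r0 : r ≠ 0 := fun h => had (hr0 h).symm
  have r1 : r - 1 ≠ 0 := fun h => hbd (hr1 (sub_eq_zero.1 h)).symm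
  have f3 : r * (r - 1) * f E₂ = 0 := by linear_combination -f2 - r * f1
  have f4 : f E₂ = 0 := (mul_eq_zero.1 f3).resolve_left (mul_ne_zero r0 r1)
  have f5 : f E₁ = 0 := by simpa [f4] using f1
  rw [hf, f4, f5]
  simp

open scoped Classical in
/-- Four points of a circle determine almost as many points as the field has elements. -/
theorem exists_circle [Fintype F] {a b c d : K} (hab : a ≠ b) (hac : a ≠ c) (had : a ≠ d)
    (hbc : b ≠ c) (hbd : b ≠ d) (hcd : c ≠ d) (h : D.Conc a b c d) :
    ∃ P : Finset K, Fintype.card F ≤ P.card + 1 ∧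
      (∀ f : F × K × K × F →ₗ[F] F, f (D.vec a) = 0 → f (D.vec b) = 0 → f (D.vec c) = 0 →
        f (D.vec d) = 0 → ∀ z ∈ P, f (D.vec z) = 0) ∧
      ∀ x ∈ P, ∀ y ∈ P, ∀ z ∈ P, ∀ w ∈ P, D.Conc x y z w := by
  set den : F → K := fun s => (b - c) + s • (-(b - a)) with hden
  set num : F → K := fun s => a * (b - c) + s • (-(c * (b - a))) with hnum
  have ba := sub_ne_zero.2 hab.symm
  have bc := sub_ne_zero.2 hbc
  have ac := sub_ne_zero.2 hac
  -- Consequently the cross ratio of four points equals that of their parameters, which lies in `F`.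
  have diff : ∀ s s' : F, den s ≠ 0 → den s' ≠ 0 → num s / den s - num s' / den s' =
      algebraMap F K (s - s') * ((a - c) * (b - a) * (b - c)) / (den s * den s') := by
    intro s s' h h'
    rw [div_sub_div _ _ h h']
    congr 1
    simp only [hnum, hden, Algebra.smul_def, map_sub]
    ring
  refine ⟨(Finset.univ.filter fun s => den s ≠ 0).image fun s => num s / den s, ?_, ?_, ?_⟩
  · rw [Finset.card_image_of_injOn]
    · have h1 := Finset.card_filter_add_card_filter_not (s := (Finset.univ : Finset F))
        (fun s => den s ≠ 0)
      -- At most one parameter is lost, that of the point at infinity.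
      have h2 : (Finset.univ.filter fun s : F => ¬ den s ≠ 0).card ≤ 1 := by
        rw [Finset.card_le_one]
        intro s hs s' hs'
        simp only [Finset.mem_filter, Finset.mem_univ, true_and, not_not] at hs hs'
        have h3 : (s - s') • (b - a) = 0 := by
          simp only [hden] at hs hs'
          rw [sub_smul]
          simp only [smul_neg] at hs hs'
          linear_combination hs' - hs
        rcases smul_eq_zero.1 h3 with h | h
        · exact sub_eq_zero.1 h
        · exact absurd h ba
      rw [Finset.card_univ] at h1
      omega
    · intro s hs s' hs' hss
      simp only [Finset.coe_filter, Finset.mem_univ, true_and, Set.mem_ofPred_eq] at hs hs'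
      have h1 := diff s s' hs hs'
      simp only at hss
      rw [hss, sub_self, eq_comm, div_eq_zero_iff] at h1
      have h2 := h1.resolve_right (mul_ne_zero hs hs')
      have h3 := (mul_eq_zero.1 h2).resolve_right (mul_ne_zero (mul_ne_zero ac ba) bc)
      rw [map_eq_zero] at h3
      exact sub_eq_zero.1 h3
  · intro f ha hb hc hd z hz
    simp only [Finset.mem_image, Finset.mem_filter, Finset.mem_univ, true_and] at hz
    obtain ⟨s, hs, rfl⟩ := hz
    have h1 := eq_zero_on_circle hab hac had hbc hbd hcd h ha hb hc hd s
    have h2 : a * (b - c) + s • (-(c * (b - a))) = num s / den s * den s := by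
      rw [div_mul_cancel₀ _ hs]
    change f (D.hvec (a * (b - c) + s • (-(c * (b - a)))) (den s)) = 0 at h1
    rw [h2, hvec_mul, map_smul, smul_eq_zero] at h1
    refine h1.resolve_left ?_
    have := D.nm_ne_zero hs
    rwa [map_ne_zero] at this
  · intro x hx y hy z hz w hw
    simp only [Finset.mem_image, Finset.mem_filter, Finset.mem_univ, true_and] at hx hy hz hw
    obtain ⟨s₁, h1, rfl⟩ := hx
    obtain ⟨s₂, h2, rfl⟩ := hy
    obtain ⟨s₃, h3, rfl⟩ := hz
    obtain ⟨s₄, h4, rfl⟩ := hw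
    rw [conc_iff, diff _ _ h4 h1, diff _ _ h2 h3, diff _ _ h4 h3, diff _ _ h2 h1]
    have g : ∀ s, den s ≠ 0 → (D.σ : K →+* K) (den s) ≠ 0 := fun s hs => (map_ne_zero _).2 hs
    have g1 := g _ h1
    have g2 := g _ h2
    have g3 := g _ h3
    have g4 := g _ h4
    simp only [map_mul, map_div₀, algebraMap_fixed]
    field_simp

/-- A point other than `c` is determined by its parameter in `F`; `c` itself has parameter infinity.
-/
theorem card_conc_le [Fintype F] {a b c : K} (hab : a ≠ b) (hac : a ≠ c) (hbc : b ≠ c)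
    (P : Finset K) (hP : ∀ e ∈ P, D.Conc a b c e ∧ e ≠ c) : P.card ≤ Fintype.card F := by
  choose! g hg1 hg2 _ _ using fun e (he : e ∈ P) =>
    exists_param hab hac hbc (hP e he).2 (hP e he).1
  rw [← Finset.card_univ]
  refine Finset.card_le_card_of_injOn g (fun _ _ => Finset.mem_univ _) ?_
  intro e he e' he' h
  have h1 := hg2 e he
  have h2 := hg2 e' he'
  rw [← h, h1] at h2
  exact mul_right_cancel₀ (hg1 e he) h2

end Circle

end CubicData

/-! ### Equidistribution of values of linear forms -/

section Counting

/-- Summing over a finite group a function of the image under a surjective homomorphism. -/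
theorem card_mul_sum_comp_surjective {A B : Type*} [AddCommGroup A] [Fintype A] [AddCommGroup B]
    [Fintype B] (φ : A →+ B) (hφ : Function.Surjective φ) (g : B → ℕ) :
    Fintype.card B * ∑ a, g (φ a) = Fintype.card A * ∑ b, g b := by
  classical
  have hfib : ∀ b, (Finset.univ.filter fun a => φ a = b).card =
      (Finset.univ.filter fun a => φ a = 0).card := fun b =>
    AddMonoidHom.card_fiber_eq_of_mem_range φ (hφ b) (hφ 0)
  set m := (Finset.univ.filter fun a => φ a = 0).card with hm
  have hA : Fintype.card A = Fintype.card B * m := by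
    rw [← Finset.card_univ, Finset.card_eq_sum_card_fiberwise (f := φ) (t := Finset.univ)
      (fun _ _ => Finset.mem_univ _)]
    simp [hfib]
  have hS : ∑ a, g (φ a) = m * ∑ b, g b := by
    rw [← Finset.sum_fiberwise (s := Finset.univ) (g := φ), Finset.mul_sum]
    refine Finset.sum_congr rfl fun b _ => ?_
    rw [Finset.sum_congr rfl (g := fun _ => g b)
      (fun a ha => by rw [(Finset.mem_filter.1 ha).2]), Finset.sum_const, hfib, smul_eq_mul]
  rw [hA, hS]; ring

variable {F E : Type*} [Field F] [AddCommGroup E] [Module F E]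

theorem exists_dual_family {ι : Type*} [Fintype ι] [DecidableEq ι] {w : ι → E}
    (hw : LinearIndependent F w) :
    ∃ g : ι → (E →ₗ[F] F), ∀ i j, g i (w j) = if i = j then 1 else 0 := by
  obtain ⟨g, hg⟩ := LinearMap.exists_leftInverse_of_injective (Fintype.linearCombination F w)
    (LinearMap.ker_eq_bot.2 hw.fintypeLinearCombination_injective)
  refine ⟨fun i => (LinearMap.proj i).comp g, fun i j => ?_⟩
  have := congrArg (fun h => h (Pi.single j 1)) hg
  simp only [LinearMap.comp_apply, Fintype.linearCombination_apply_single, one_smul,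
    LinearMap.id_apply] at this
  simp only [LinearMap.comp_apply, this, LinearMap.proj_apply, Pi.single_apply]

theorem exists_form_eq {ι : Type*} [Fintype ι] [DecidableEq ι] {w : ι → E}
    (hw : LinearIndependent F w) (y : ι → F) : ∃ f : E →ₗ[F] F, ∀ i, f (w i) = y i := by
  obtain ⟨g, hg⟩ := exists_dual_family hw
  exact ⟨∑ i, y i • g i, fun j => by simp [LinearMap.sum_apply, hg]⟩

noncomputable instance dualFintype [Finite E] [Finite F] : Fintype (E →ₗ[F] F) :=
  haveI : Finite (E →ₗ[F] F) := Finite.of_injective (fun f => (f : E → F)) DFunLike.coe_injective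
  Fintype.ofFinite _

variable [Fintype F] [Finite E]

variable (F) in
open scoped Classical in
/-- The linear forms that vanish at the members of a family. -/
noncomputable def annih {ι : Type*} (w : ι → E) : Finset (E →ₗ[F] F) :=
  Finset.univ.filter fun g => ∀ i, g (w i) = 0

theorem mem_annih {ι : Type*} {w : ι → E} {g : E →ₗ[F] F} :
    g ∈ annih F w ↔ ∀ i, g (w i) = 0 := by
  simp [annih]

/-- Evaluation at independent vectors is a surjective homomorphism, so all its fibres have equal
size. -/
theorem card_annih {r : ℕ} {w : Fin r → E} (hw : LinearIndependent F w) :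
    Fintype.card F ^ r * (annih F w).card = Fintype.card (E →ₗ[F] F) := by
  classical
  have h := card_mul_sum_comp_surjective
    (A := E →ₗ[F] F) (B := Fin r → F)
    { toFun := fun g i => g (w i), map_zero' := rfl, map_add' := fun _ _ => rfl }
    (fun y => by
      obtain ⟨f, hf⟩ := exists_form_eq hw y
      exact ⟨f, funext hf⟩) (fun y => if y = 0 then 1 else 0)
  simp only [Fintype.card_fun, Fintype.card_fin, Finset.sum_ite_eq', Finset.mem_univ, if_true,
    mul_one, Finset.sum_boole] at h
  rw [← h, annih, Nat.cast_id]
  congr 2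
  ext g
  simp [funext_iff]

open scoped Classical in
theorem card_mul_sum_form_apply {w : E} (hw : LinearIndependent F (fun _ : Fin 1 => w)) (y : F) :
    Fintype.card F * ∑ m : E →ₗ[F] F, (if m w = y then 1 else 0) =
      Fintype.card (E →ₗ[F] F) := by
  have := card_mul_sum_comp_surjective (A := E →ₗ[F] F) (B := F)
    { toFun := fun m => m w, map_zero' := rfl, map_add' := fun _ _ => rfl }
    (fun y => (exists_form_eq hw fun _ => y).imp fun _ hf => hf 0)
    (fun z => if z = y then 1 else 0)
  rw [Finset.sum_ite_eq', if_pos (Finset.mem_univ _), mul_one] at this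
  exact this

end Counting

section Dual

variable {F K : Type*} [Field F] [Field K] [Algebra F K] [Fintype F] [Finite K]

theorem card_dual (hK : Nat.card K = Fintype.card F ^ 3) :
    Fintype.card (F × K × K × F →ₗ[F] F) = Fintype.card F ^ 8 := by
  have : Module.Finite F K := Module.Finite.of_finite
  have h3 : Module.finrank F K = 3 := by
    have := Module.natCard_eq_pow_finrank (K := F) (V := K)
    rw [hK, Nat.card_eq_fintype_card] at this
    exact (Nat.pow_right_injective (Fintype.one_lt_card (α := F)) this).symm
  rw [← Nat.card_eq_fintype_card, Module.natCard_eq_pow_finrank (K := F),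
    Nat.card_eq_fintype_card, Module.finrank_linearMap]
  simp [Module.finrank_prod, h3]

end Dual

/-! ### Zeros of three random linear forms -/

namespace CubicData

variable {F K : Type*} [Field F] [Field K] [Algebra F K] {D : CubicData F K}

theorem vec_linearIndependent_one (z : K) : LinearIndependent F (fun _ : Fin 1 => D.vec z) := by
  rw [Fintype.linearIndependent_iff]
  intro l hl i
  have := congrArg Prod.fst hl
  fin_cases i
  simpa [vec] using this

variable [Fintype K]

variable (D) in
open scoped Classical in
/-- The points of `K` at which three linear forms vanish. -/
noncomputable def zeros (f : Fin 3 → (F × K × K × F →ₗ[F] F)) : Finset K :=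
  Finset.univ.filter fun z => ∀ i, f i (D.vec z) = 0

theorem mem_zeros {f : Fin 3 → (F × K × K × F →ₗ[F] F)} {z : K} :
    z ∈ D.zeros f ↔ ∀ i, f i (D.vec z) = 0 := by
  simp [zeros]

variable (D) in
open scoped Classical in
/-- The quadruples of distinct concyclic points. -/
noncomputable def concTuples : Finset (Fin 4 ↪ K) :=
  Finset.univ.filter fun e => D.Conc (e 0) (e 1) (e 2) (e 3)

theorem mem_concTuples {e : Fin 4 ↪ K} :
    e ∈ D.concTuples ↔ D.Conc (e 0) (e 1) (e 2) (e 3) := by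
  simp [concTuples]

variable [Fintype F]

theorem card_annih_eq {r s : ℕ} (hrs : r + s = 8) (hK : Nat.card K = Fintype.card F ^ 3)
    {w : Fin r → F × K × K × F} (hw : LinearIndependent F w) :
    (annih F w).card = Fintype.card F ^ s := by
  have h := card_annih hw
  rw [card_dual hK, ← hrs, pow_add] at h
  exact Nat.eq_of_mul_eq_mul_left (pow_pos Fintype.card_pos _) h

/-- Six independent vectors are annihilated by only `t ^ 2` forms, but the span of `f` has `t ^ 3`.
So no six of the seven zeros are independent, and `exists_concyclic` applies. -/
theorem exists_concyclic_of_linearIndependent (hK : Nat.card K = Fintype.card F ^ 3)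
    {f : Fin 3 → (F × K × K × F →ₗ[F] F)} (hf : LinearIndependent F f)
    (h7 : 7 ≤ (D.zeros f).card) :
    ∃ z : Fin 4 → K, Function.Injective z ∧ (∀ i, z i ∈ D.zeros f) ∧
      D.Conc (z 0) (z 1) (z 2) (z 3) := by
  obtain ⟨P, hP, hP7⟩ := Finset.exists_subset_card_eq h7
  let e := (P.equivFin.trans (finCongr hP7)).symm
  have hz : Function.Injective (fun i => (e i : K)) :=
    Subtype.val_injective.comp e.injective
  obtain ⟨i, j, k, l, hij, hik, hil, hjk, hjl, hkl, hc⟩ := exists_concyclic (D := D) hz (by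
    intro g hg
    have hc := card_annih_eq (r := 6) (s := 2) rfl hK hg
    have hinj : Function.Injective (Fintype.linearCombination F f) :=
      hf.fintypeLinearCombination_injective
    have : Fintype.card (Fin 3 → F) ≤ (annih F (fun i => D.vec (e (g i) : K))).card := by
      rw [← Finset.card_univ]
      refine Finset.card_le_card_of_injOn _ (fun c _ => ?_) hinj.injOn
      simp only [Finset.mem_coe, mem_annih]
      intro i
      have : ∀ j, f j (D.vec (e (g i) : K)) = 0 := mem_zeros.1 (hP (e (g i)).2)
      simp [Fintype.linearCombination_apply, LinearMap.sum_apply, this]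
    rw [hc, Fintype.card_fun, Fintype.card_fin] at this
    exact absurd this (not_le.2 (Nat.pow_lt_pow_right (Fintype.one_lt_card (α := F)) (by norm_num))))
  refine ⟨![e i, e j, e k, e l], ?_, ?_, hc⟩
  · have hne : ∀ {i j : Fin 7}, i ≠ j → (e i : K) ≠ e j := fun h h' => h (hz h')
    intro a b hab
    fin_cases a <;> fin_cases b <;>
      simp [hne hij, hne hik, hne hil, hne hjk, hne hjl, hne hkl, hne hij.symm, hne hik.symm,
        hne hil.symm, hne hjk.symm, hne hjl.symm, hne hkl.symm] at hab ⊢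
  · intro a
    fin_cases a <;> exact hP (Subtype.property _)

open scoped Classical in
theorem le_card_concTuples_zeros (hK : Nat.card K = Fintype.card F ^ 3)
    {f : Fin 3 → (F × K × K × F →ₗ[F] F)} (hf : LinearIndependent F f)
    (h7 : 7 ≤ (D.zeros f).card) :
    (Fintype.card F - 4) ^ 4 ≤
      (D.concTuples.filter fun e => ∀ i, e i ∈ D.zeros f).card := by
  obtain ⟨z, hz, hz0, hc⟩ := exists_concyclic_of_linearIndependent hK hf h7
  obtain ⟨P, hP, hPf, hPc⟩ := exists_circle (D := D) (hz.ne (by decide : (0 : Fin 4) ≠ 1))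
    (hz.ne (by decide : (0 : Fin 4) ≠ 2)) (hz.ne (by decide : (0 : Fin 4) ≠ 3))
    (hz.ne (by decide : (1 : Fin 4) ≠ 2)) (hz.ne (by decide : (1 : Fin 4) ≠ 3))
    (hz.ne (by decide : (2 : Fin 4) ≠ 3)) hc
  have h1 : Fintype.card (Fin 4 ↪ P) ≤
      (D.concTuples.filter fun e => ∀ i, e i ∈ D.zeros f).card := by
    rw [← Finset.card_univ]
    refine Finset.card_le_card_of_injOn
      (fun e => e.trans (Function.Embedding.subtype _)) (fun e _ => ?_) ?_
    · simp only [Finset.mem_coe, Finset.mem_filter, mem_concTuples]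
      refine ⟨hPc _ (e 0).2 _ (e 1).2 _ (e 2).2 _ (e 3).2, fun i => mem_zeros.2 fun j => ?_⟩
      exact hPf (f j) (mem_zeros.1 (hz0 0) j) (mem_zeros.1 (hz0 1) j) (mem_zeros.1 (hz0 2) j)
        (mem_zeros.1 (hz0 3) j) _ (e i).2
    · intro e _ e' _ h
      ext i
      exact congrArg (fun h : Fin 4 ↪ K => h i) h
  refine le_trans ?_ h1
  rw [Fintype.card_embedding_eq, Fintype.card_coe, Fintype.card_fin]
  -- The circle supplies at least `t - 1` points, and four distinct ones are chosen in order.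
  refine le_trans (Nat.pow_le_pow_left ?_ 4) (Nat.pow_sub_le_descFactorial _ _)
  omega

theorem card_concTuples_le (hK : Nat.card K = Fintype.card F ^ 3) :
    D.concTuples.card ≤ Fintype.card F ^ 10 := by
  classical
  have h := Finset.card_le_mul_card_image (s := D.concTuples)
    (f := fun e => (e 0, e 1, e 2)) (n := Fintype.card F) (fun b hb => by
      obtain ⟨e₀, he₀, rfl⟩ := Finset.mem_image.1 hb
      have hne := fun {i j : Fin 4} (h : i ≠ j) => e₀.injective.ne h
      refine le_trans ?_ (card_conc_le (D := D) (hne (by decide : (0 : Fin 4) ≠ 1))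
        (hne (by decide : (0 : Fin 4) ≠ 2)) (hne (by decide : (1 : Fin 4) ≠ 2))
        (Finset.univ.filter fun e => D.Conc (e₀ 0) (e₀ 1) (e₀ 2) e ∧ e ≠ e₀ 2)
        (fun e he => (Finset.mem_filter.1 he).2))
      refine Finset.card_le_card_of_injOn (fun e => e 3) (fun e he => ?_) ?_
      · simp only [Finset.mem_coe, Finset.mem_filter, mem_concTuples, Prod.mk.injEq] at he ⊢
        obtain ⟨hc, h0, h1, h2⟩ := he
        rw [← h0, ← h1, ← h2]
        exact ⟨Finset.mem_univ _, hc, e.injective.ne (by decide)⟩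
      · intro e he e' he' h3
        simp only [Finset.mem_coe, Finset.mem_filter, Prod.mk.injEq] at he he'
        obtain ⟨-, h0, h1, h2⟩ := he
        obtain ⟨-, h0', h1', h2'⟩ := he'
        ext i
        fin_cases i
        · exact h0.trans h0'.symm
        · exact h1.trans h1'.symm
        · exact h2.trans h2'.symm
        · exact h3)
  refine h.trans ?_
  calc _ ≤ Fintype.card F * Fintype.card (K × K × K) :=
        Nat.mul_le_mul_left _ (Finset.card_le_univ _)
    _ = _ := by
      rw [Fintype.card_prod, Fintype.card_prod, ← Nat.card_eq_fintype_card (α := K), hK]; ring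

open scoped Classical in
-- At most `t + 1` points `z` lie on the circle and impose perhaps no new condition, which gives `(t
-- ^ 4) ^ 3` each. Each of the at most `t ^ 3` others imposes a fifth condition, which gives `(t ^
-- 3) ^ 3`.
theorem sum_card_annih_le (hK : Nat.card K = Fintype.card F ^ 3) {e : Fin 4 ↪ K}
    (he : e ∈ D.concTuples) :
    ∑ z, (annih F (fun i => D.vec (![e 0, e 1, e 2, e 3, z] i))).card ^ 3 ≤
      (Fintype.card F + 2) * Fintype.card F ^ 12 := by
  rw [mem_concTuples] at he
  have hne := fun {i j : Fin 4} (h : i ≠ j) => e.injective.ne h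
  have h01 := hne (by decide : (0 : Fin 4) ≠ 1)
  have h02 := hne (by decide : (0 : Fin 4) ≠ 2)
  have h03 := hne (by decide : (0 : Fin 4) ≠ 3)
  have h12 := hne (by decide : (1 : Fin 4) ≠ 2)
  have h13 := hne (by decide : (1 : Fin 4) ≠ 3)
  have h23 := hne (by decide : (2 : Fin 4) ≠ 3)
  set t := Fintype.card F with ht
  let Q : Finset K := Finset.univ.filter fun z => D.Conc (e 0) (e 1) (e 2) z ∧ z ≠ e 2
  have hQ : Q.card ≤ t := card_conc_le (D := D) h01 h02 h12 Q
    fun z hz => (Finset.mem_filter.1 hz).2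
  have h4 : ∀ z, (annih F (fun i => D.vec (![e 0, e 1, e 2, e 3, z] i))).card ≤ t ^ 4 := by
    intro z
    rw [← card_annih_eq (r := 4) (s := 4) rfl hK
      (linearIndependent_four h01 h02 h03 h12 h13 h23)]
    refine Finset.card_le_card fun g hg => ?_
    rw [mem_annih] at hg ⊢
    intro i
    have := hg i.castSucc
    fin_cases i <;> exact this
  have h5 : ∀ z ∉ insert (e 2) Q,
      (annih F (fun i => D.vec (![e 0, e 1, e 2, e 3, z] i))).card ≤ t ^ 3 := by
    intro z hz
    simp only [Finset.mem_insert, not_or, Q, Finset.mem_filter, Finset.mem_univ, true_and,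
      not_and_or, not_not] at hz
    rw [card_annih_eq (r := 5) (s := 3) rfl hK (linearIndependent_five h01 h02 h03 h12 h13 h23
      hz.1 he (hz.2.resolve_right hz.1))]
  rw [← Finset.sum_add_sum_compl (insert (e 2) Q)]
  calc _ ≤ ∑ z ∈ insert (e 2) Q, (t ^ 4) ^ 3 + ∑ z ∈ (insert (e 2) Q)ᶜ, (t ^ 3) ^ 3 :=
        add_le_add (Finset.sum_le_sum fun z _ => Nat.pow_le_pow_left (h4 z) 3)
          (Finset.sum_le_sum fun z hz => Nat.pow_le_pow_left (h5 z (Finset.mem_compl.1 hz)) 3)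
    _ ≤ (t + 1) * (t ^ 4) ^ 3 + t ^ 3 * (t ^ 3) ^ 3 := by
        rw [Finset.sum_const, Finset.sum_const, smul_eq_mul, smul_eq_mul]
        refine add_le_add (Nat.mul_le_mul_right _ ?_) (Nat.mul_le_mul_right _ ?_)
        · exact (Finset.card_insert_le _ _).trans (by omega)
        · rw [← hK, Nat.card_eq_fintype_card]
          exact Finset.card_le_univ _
    _ = _ := by ring

open scoped Classical in
theorem sum_card_zeros_mul_le (hK : Nat.card K = Fintype.card F ^ 3) :
    ∑ f, (D.zeros f).card * (D.concTuples.filter fun e => ∀ i, e i ∈ D.zeros f).card ≤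
      Fintype.card F ^ 10 * ((Fintype.card F + 2) * Fintype.card F ^ 12) := by
  have h1 : ∀ f, (D.zeros f).card * (D.concTuples.filter fun e => ∀ i, e i ∈ D.zeros f).card =
      ∑ e ∈ D.concTuples, ∑ z, if z ∈ D.zeros f ∧ ∀ i, e i ∈ D.zeros f then 1 else 0 := by
    intro f
    rw [mul_comm, Finset.card_filter, Finset.sum_mul]
    refine Finset.sum_congr rfl fun e _ => ?_
    by_cases h : ∀ i, e i ∈ D.zeros f <;> simp [h]
  simp only [h1]
  rw [Finset.sum_comm]
  calc _ ≤ ∑ e ∈ D.concTuples, (Fintype.card F + 2) * Fintype.card F ^ 12 := by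
        refine Finset.sum_le_sum fun e he => ?_
        rw [Finset.sum_comm]
        refine le_trans (Finset.sum_le_sum fun z _ => ?_) (sum_card_annih_le hK he)
        have hpi := Fintype.card_piFinset
          (fun _ : Fin 3 => annih F (fun i => D.vec (![e 0, e 1, e 2, e 3, z] i)))
        rw [Finset.prod_const, Finset.card_univ, Fintype.card_fin] at hpi
        rw [← Finset.card_filter, ← hpi]
        refine Finset.card_le_card fun f hf => ?_
        simp only [Finset.mem_filter, Finset.mem_univ, true_and, mem_zeros] at hf
        rw [Fintype.mem_piFinset]
        intro j
        rw [mem_annih]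
        intro i
        fin_cases i
        · exact hf.2 0 j
        · exact hf.2 1 j
        · exact hf.2 2 j
        · exact hf.2 3 j
        · exact hf.1 j
    _ ≤ _ := by
        rw [Finset.sum_const, smul_eq_mul]
        exact Nat.mul_le_mul_right _ (card_concTuples_le hK)

open scoped Classical in
-- One form is a combination of the other two: `3 * t ^ 2` choices of index and coefficients, `t ^
-- 3` of the zero, and `t ^ 7` of each of the two forms vanishing there.
theorem sum_card_zeros_of_dependent_le (hK : Nat.card K = Fintype.card F ^ 3) :
    ∑ f with ¬ LinearIndependent F f, (D.zeros f).card ≤ 3 * Fintype.card F ^ 19 := by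
  let A : K → Finset (F × K × K × F →ₗ[F] F) := fun z => annih F (fun _ : Fin 1 => D.vec z)
  let S := (Finset.univ : Finset (Fin 3 × F × F)) ×ˢ
    ((Finset.univ : Finset K).sigma fun z => A z ×ˢ A z)
  have hS : S.card = 3 * Fintype.card F ^ 19 := by
    have hA : ∀ z, (A z).card = Fintype.card F ^ 7 := fun z =>
      card_annih_eq rfl hK (vec_linearIndependent_one z)
    simp only [S, Finset.card_product, Finset.card_sigma, hA, Finset.sum_const, Finset.card_univ,
      ← Nat.card_eq_fintype_card (α := K), hK, Fintype.card_prod, Fintype.card_fin, smul_eq_mul]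
    ring
  rw [← hS]
  rw [← Finset.card_sigma]
  refine Finset.card_le_card_of_surjOn
    (fun s => ⟨fun j => if j = s.1.1 then s.1.2.1 • s.2.2.1 + s.1.2.2 • s.2.2.2 else
      if j = s.1.1 + 1 then s.2.2.1 else s.2.2.2, s.2.1⟩) ?_
  rintro ⟨f, z⟩ hfz
  simp only [Finset.mem_coe, Finset.mem_sigma, Finset.mem_filter, Finset.mem_univ, true_and,
    mem_zeros] at hfz
  obtain ⟨hf, hz⟩ := hfz
  obtain ⟨l, hl, i, hi⟩ := Fintype.not_linearIndependent_iff.1 hf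
  have key : f i = (-(l i)⁻¹ * l (i + 1)) • f (i + 1) + (-(l i)⁻¹ * l (i + 2)) • f (i + 2) := by
    have h3 : l i • f i + (l (i + 1) • f (i + 1) + l (i + 2) • f (i + 2)) = 0 := by
      rw [← hl, Fin.sum_univ_three]
      fin_cases i <;> simp <;> abel
    rw [add_eq_zero_iff_eq_neg] at h3
    calc f i = (l i)⁻¹ • (l i • f i) := by rw [smul_smul, inv_mul_cancel₀ hi, one_smul]
      _ = _ := by rw [h3, smul_neg, smul_add, smul_smul, smul_smul, neg_add, ← neg_smul,
        ← neg_smul, neg_mul, neg_mul]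
  refine ⟨⟨⟨i, -(l i)⁻¹ * l (i + 1), -(l i)⁻¹ * l (i + 2)⟩, ⟨z, f (i + 1), f (i + 2)⟩⟩, ?_, ?_⟩
  · simp only [S, A, Finset.mem_coe, Finset.mem_product, Finset.mem_univ, true_and,
      Finset.mem_sigma, mem_annih]
    exact ⟨fun _ => hz _, fun _ => hz _⟩
  · simp only [Sigma.mk.injEq, heq_eq_eq, and_true]
    rw [← key]
    funext j
    fin_cases i <;> fin_cases j <;> simp

/-- For independent triples with seven zeros, each zero is weighted by the at least `(t - 4) ^ 4`
concyclic quadruples of zeros, and `sum_card_zeros_mul_le` bounds the weighted sum. The bound is `t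
^ (-5)` per triple of forms, up to a constant. -/
theorem sum_card_zeros_le (hK : Nat.card K = Fintype.card F ^ 3) (ht : 16 ≤ Fintype.card F) :
    ∑ f, (if 7 ≤ (D.zeros f).card then (D.zeros f).card else 0) ≤ 12 * Fintype.card F ^ 19 := by
  classical
  set t := Fintype.card F
  -- From `16 ≤ t`, `t - 4` is at least `3 * t / 4`, and `(4 / 3) ^ 4 < 4`.
  have ht4 : t ^ 4 ≤ 4 * (t - 4) ^ 4 := by
    have h : 3 * t ≤ 4 * (t - 4) := by omega
    have := Nat.pow_le_pow_left h 4
    rw [mul_pow, mul_pow] at this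
    omega
  have hβ : t ^ 4 * ∑ f with LinearIndependent F f,
      (if 7 ≤ (D.zeros f).card then (D.zeros f).card else 0) ≤
      4 * (t ^ 10 * ((t + 2) * t ^ 12)) := by
    refine le_trans ?_ (Nat.mul_le_mul_left 4 (sum_card_zeros_mul_le (D := D) hK))
    rw [Finset.mul_sum, Finset.mul_sum]
    refine (Finset.sum_le_sum fun f hf => ?_).trans
      (Finset.sum_le_sum_of_subset (Finset.filter_subset _ _))
    split_ifs with h7
    · have := le_card_concTuples_zeros hK (Finset.mem_filter.1 hf).2 h7
      calc t ^ 4 * (D.zeros f).card ≤ (4 * (t - 4) ^ 4) * (D.zeros f).card :=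
            Nat.mul_le_mul_right _ ht4
        _ = 4 * ((D.zeros f).card * (t - 4) ^ 4) := by ring
        _ ≤ _ := by gcongr
    · simp
  have hα : ∑ f with ¬ LinearIndependent F f,
      (if 7 ≤ (D.zeros f).card then (D.zeros f).card else 0) ≤ 3 * t ^ 19 :=
    (Finset.sum_le_sum fun f _ => by split_ifs <;> simp).trans
      (sum_card_zeros_of_dependent_le (D := D) hK)
  rw [← Finset.sum_filter_add_sum_filter_not Finset.univ (fun f => LinearIndependent F f)]
  have hβ' : ∑ f with LinearIndependent F f,
      (if 7 ≤ (D.zeros f).card then (D.zeros f).card else 0) ≤ 8 * t ^ 19 := by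
    refine Nat.le_of_mul_le_mul_left (hβ.trans ?_) (pow_pos (by omega : 0 < t) 4)
    calc 4 * (t ^ 10 * ((t + 2) * t ^ 12)) = 4 * (t + 2) * t ^ 22 := by ring
      _ ≤ (8 * t) * t ^ 22 := Nat.mul_le_mul_right _ (by omega)
      _ = _ := by ring
  omega

end CubicData

/-! ### Random trilinear forms and their slices -/

section Trilinear

variable {F E : Type*} [Field F] [AddCommGroup E] [Module F E]

/-- The linear form obtained by fixing the first two arguments of a trilinear form. -/
def slice (T : MultilinearMap F (fun _ : Fin 3 => E) F) (a b : E) : E →ₗ[F] F :=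
  T.toLinearMap ![a, b, 0] 2

theorem slice_apply (T : MultilinearMap F (fun _ : Fin 3 => E) F) (a b z : E) :
    slice T a b z = T ![a, b, z] := by
  rw [slice, MultilinearMap.toLinearMap_apply]
  congr 1
  funext i
  fin_cases i <;> rfl

theorem slice_add (T T' : MultilinearMap F (fun _ : Fin 3 => E) F) (a b : E) :
    slice (T + T') a b = slice T a b + slice T' a b := by
  ext z
  simp [slice_apply]

theorem slice_zero (a b : E) :
    slice (0 : MultilinearMap F (fun _ : Fin 3 => E) F) a b = 0 := by
  ext z
  simp [slice_apply]

/-- The product of three linear forms, as a trilinear form. -/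
def prodForm (g h m : E →ₗ[F] F) : MultilinearMap F (fun _ : Fin 3 => E) F :=
  (MultilinearMap.mkPiAlgebra F (Fin 3) F).compLinearMap ![g, h, m]

theorem prodForm_apply (g h m : E →ₗ[F] F) (x : Fin 3 → E) :
    prodForm g h m x = g (x 0) * h (x 1) * m (x 2) := by
  simp [prodForm, Fin.prod_univ_three]

theorem exists_slice_eq {u w : Fin 2 → E} (hu : LinearIndependent F u)
    (hw : LinearIndependent F w) (m : Fin 2 → Fin 2 → (E →ₗ[F] F)) :
    ∃ T : MultilinearMap F (fun _ : Fin 3 => E) F, ∀ i j, slice T (u i) (w j) = m i j := by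
  obtain ⟨g, hg⟩ := exists_dual_family hu
  obtain ⟨h, hh⟩ := exists_dual_family hw
  refine ⟨∑ i, ∑ j, prodForm (g i) (h j) (m i j), fun i j => ?_⟩
  ext z
  rw [slice_apply]
  fin_cases i <;> fin_cases j <;> simp [prodForm_apply, hg, hh]

theorem exists_apply_eq {x : Fin 3 → E} (hx : ∀ i, LinearIndependent F (fun _ : Fin 1 => x i))
    (y : F) : ∃ T : MultilinearMap F (fun _ : Fin 3 => E) F, T x = y := by
  choose g hg using fun i => exists_form_eq (hx i) (fun _ => 1)
  refine ⟨y • prodForm (g 0) (g 1) (g 2), ?_⟩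
  rw [smul_apply, prodForm_apply, hg 0 0, hg 1 0, hg 2 0]
  simp

/-- The slice at the first corner of a quadrilateral and the three combinations of slices that
eliminate the label of the third vertex. -/
def corners (u w : Fin 2 → E) (ψ : Fin 2 → Fin 2 → F) :
    MultilinearMap F (fun _ : Fin 3 => E) F →+ (E →ₗ[F] F) × (Fin 3 → (E →ₗ[F] F)) where
  toFun T := (slice T (u 0) (w 0),
    ![ψ 0 0 • slice T (u 0) (w 1) - ψ 0 1 • slice T (u 0) (w 0),
      ψ 0 0 • slice T (u 1) (w 0) - ψ 1 0 • slice T (u 0) (w 0),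
      ψ 0 0 • slice T (u 1) (w 1) - ψ 1 1 • slice T (u 0) (w 0)])
  map_zero' := by
    simp only [slice_zero, smul_zero, sub_zero]
    ext i
    · rfl
    · fin_cases i <;> rfl
  map_add' T T' := by
    simp only [slice_add, Prod.mk_add_mk, Matrix.add_cons, smul_add, Matrix.head_cons,
      Matrix.tail_cons, Matrix.empty_add_empty, add_sub_add_comm]

/-- The four slices can be prescribed freely, and `corners` is an invertible triangular
transformation of them. So a uniform `T` gives four independent uniform linear forms. -/
theorem corners_surjective {u w : Fin 2 → E} (hu : LinearIndependent F u)
    (hw : LinearIndependent F w) {ψ : Fin 2 → Fin 2 → F} (hψ : ψ 0 0 ≠ 0) :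
    Function.Surjective (corners u w ψ) := by
  rintro ⟨m, f⟩
  obtain ⟨T, hT⟩ := exists_slice_eq hu hw
    ![![m, (ψ 0 0)⁻¹ • (f 0 + ψ 0 1 • m)],
      ![(ψ 0 0)⁻¹ • (f 1 + ψ 1 0 • m), (ψ 0 0)⁻¹ • (f 2 + ψ 1 1 • m)]]
  refine ⟨T, ?_⟩
  simp only [corners, AddMonoidHom.coe_mk, ZeroHom.coe_mk, hT, Matrix.cons_val_zero,
    Matrix.cons_val_one, smul_smul, mul_inv_cancel₀ hψ, one_smul, add_sub_cancel_right]
  congr 1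
  funext i
  fin_cases i <;> rfl

noncomputable instance trilinearFintype [Finite E] [Finite F] :
    Fintype (MultilinearMap F (fun _ : Fin 3 => E) F) :=
  haveI : Finite (MultilinearMap F (fun _ : Fin 3 => E) F) :=
    Finite.of_injective (fun f => (f : (Fin 3 → E) → F)) DFunLike.coe_injective
  Fintype.ofFinite _

open scoped Classical in
theorem card_mul_sum_apply [Finite E] [Fintype F] {x : Fin 3 → E}
    (hx : ∀ i, LinearIndependent F (fun _ : Fin 1 => x i)) (y : F) :
    Fintype.card F * ∑ T : MultilinearMap F (fun _ : Fin 3 => E) F, (if T x = y then 1 else 0) =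
      Fintype.card (MultilinearMap F (fun _ : Fin 3 => E) F) := by
  have := card_mul_sum_comp_surjective (A := MultilinearMap F (fun _ : Fin 3 => E) F) (B := F)
    { toFun := fun T => T x, map_zero' := rfl, map_add' := fun _ _ => rfl }
    (exists_apply_eq hx) (fun z => if z = y then 1 else 0)
  rw [Finset.sum_ite_eq', if_pos (Finset.mem_univ _), mul_one] at this
  exact this

end Trilinear

/-! ### The random 3-graph and the deletion of forbidden configurations -/

namespace CubicData

variable {F K : Type*} [Field F] [Field K] [Algebra F K]

/-- The trilinear forms on the eight-dimensional space. -/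
abbrev Form (F K : Type*) [Field F] [Field K] [Algebra F K] : Type _ :=
  MultilinearMap F (fun _ : Fin 3 => F × K × K × F) F

variable {C : Finset F}

/-- The triples of labelled points that are related by a trilinear form. -/
def Edge (D : CubicData F K) (T : Form F K) (x : Fin 3 → K × C) : Prop :=
  T (fun i => D.vec (x i).1) = ∏ i, ((x i).2 : F)

variable {D : CubicData F K}

theorem edge_iff {T : Form F K} {p q z : K × C} :
    D.Edge T ![p, q, z] ↔
      slice T (D.vec p.1) (D.vec q.1) (D.vec z.1) = (p.2 : F) * q.2 * z.2 := by
  rw [Edge, slice_apply, Fin.prod_univ_three]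
  have : (fun i => D.vec ((![p, q, z] : Fin 3 → K × C) i).1) =
      ![D.vec p.1, D.vec q.1, D.vec z.1] := by
    funext i
    fin_cases i <;> rfl
  rw [this]
  rfl

theorem edge_domDomCongr {T : Form F K} {π : Equiv.Perm (Fin 3)} {x : Fin 3 → K × C} :
    D.Edge (T.domDomCongr π) x ↔ D.Edge T (x ∘ π) := by
  rw [Edge, Edge, MultilinearMap.domDomCongr_apply]
  rw [← Equiv.prod_comp π]
  rfl

variable [Fintype K]

variable (D) in
open scoped Classical in
/-- The common neighbours of four pairs, for the relation given by a trilinear form. -/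
noncomputable def common (T : Form F K) (p p' q q' : K × C) : Finset (K × C) :=
  Finset.univ.filter fun z => D.Edge T ![p, q, z] ∧ D.Edge T ![p, q', z] ∧
    D.Edge T ![p', q, z] ∧ D.Edge T ![p', q', z]

theorem mem_common {T : Form F K} {p p' q q' z : K × C} : z ∈ D.common T p p' q q' ↔
    D.Edge T ![p, q, z] ∧ D.Edge T ![p, q', z] ∧
    D.Edge T ![p', q, z] ∧ D.Edge T ![p', q', z] := by
  simp [common]

variable (D) in
/-- The related triples that lie in a forbidden configuration. -/
def Bad (T : Form F K) (x : Fin 3 → K × C) : Prop :=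
  ∃ p q : K × C, (x 0).1 ≠ p.1 ∧ (x 1).1 ≠ q.1 ∧ x 2 ∈ D.common T (x 0) p (x 1) q ∧
    7 ≤ (D.common T (x 0) p (x 1) q).card

open scoped Classical in
/-- The related triples that lie in no forbidden configuration, in any order of the parts. -/
noncomputable def kept (D : CubicData F K) (C : Finset F) (T : Form F K) :
    Finset (Fin 3 → K × C) :=
  Finset.univ.filter fun x => D.Edge T x ∧
    ∀ π : Equiv.Perm (Fin 3), ¬ D.Bad (T.domDomCongr π) (x ∘ π.symm)

open scoped Classical in
theorem card_edge_le (T : Form F K) :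
    (Finset.univ.filter fun x : Fin 3 → K × C => D.Edge T x).card ≤ (kept D C T).card +
      ∑ π : Equiv.Perm (Fin 3),
        (Finset.univ.filter fun x : Fin 3 → K × C => D.Bad (T.domDomCongr π) x).card := by
  have h : ∀ π : Equiv.Perm (Fin 3),
      (Finset.univ.filter fun x : Fin 3 → K × C => D.Bad (T.domDomCongr π) (x ∘ π.symm)).card ≤
      (Finset.univ.filter fun x : Fin 3 → K × C => D.Bad (T.domDomCongr π) x).card := fun π =>
    Finset.card_le_card_of_injOn (fun x => x ∘ π.symm)
      (fun x hx => Finset.mem_filter.2 ⟨Finset.mem_univ _, (Finset.mem_filter.1 hx).2⟩)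
      (fun x _ y _ hxy => π.symm.surjective.injective_comp_right hxy)
  refine le_trans ?_ (Nat.add_le_add_left (Finset.sum_le_sum fun π _ => h π) _)
  refine le_trans ?_ (Nat.add_le_add_left Finset.card_biUnion_le _)
  refine le_trans (Finset.card_le_card fun x hx => ?_) (Finset.card_union_le _ _)
  simp only [kept, Finset.mem_union, Finset.mem_biUnion, Finset.mem_filter, Finset.mem_univ,
    true_and] at hx ⊢
  by_cases hb : ∃ π : Equiv.Perm (Fin 3), D.Bad (T.domDomCongr π) (x ∘ π.symm)
  · exact Or.inr hb
  · exact Or.inl ⟨hx, not_exists.1 hb⟩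

open scoped Classical in
/-- An upper bound for the number of common neighbours in terms of the corner forms. -/
noncomputable def cornerCount (D : CubicData F K) (C : Finset F) (c : F)
    (m : (F × K × K × F →ₗ[F] F) × (Fin 3 → (F × K × K × F →ₗ[F] F))) : ℕ :=
  if 7 ≤ (D.zeros m.2).card then
    ∑ w ∈ D.zeros m.2, ∑ a ∈ C, if m.1 (D.vec w) = c * a then 1 else 0 else 0

theorem card_common_le (hC : (0 : F) ∉ C) (T : Form F K) (p p' q q' : K × C) :
    (if 7 ≤ (D.common T p p' q q').card then (D.common T p p' q q').card else 0) ≤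
      cornerCount D C ((p.2 : F) * q.2)
        (corners ![D.vec p.1, D.vec p'.1] ![D.vec q.1, D.vec q'.1]
          ![![(p.2 : F) * q.2, (p.2 : F) * q'.2], ![(p'.2 : F) * q.2, (p'.2 : F) * q'.2]] T) := by
  classical
  have hne : ∀ a : C, (a : F) ≠ 0 := fun a h => hC (h ▸ a.2)
  set m := corners ![D.vec p.1, D.vec p'.1] ![D.vec q.1, D.vec q'.1]
    ![![(p.2 : F) * q.2, (p.2 : F) * q'.2], ![(p'.2 : F) * q.2, (p'.2 : F) * q'.2]] T with hm
  -- The four slices at `z` are the four label products times one unknown label, so the three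
  -- combinations cancel.
  have hz : ∀ z ∈ D.common T p p' q q', z.1 ∈ D.zeros m.2 := by
    intro z hz
    obtain ⟨h1, h2, h3, h4⟩ := mem_common.1 hz
    rw [edge_iff] at h1 h2 h3 h4
    rw [mem_zeros]
    intro i
    fin_cases i <;>
      simp [hm, corners, h1, h2, h3, h4] <;> ring
  have h0 : ∀ z ∈ D.common T p p' q q', m.1 (D.vec z.1) = ((p.2 : F) * q.2) * z.2 := by
    intro z hz
    exact edge_iff.1 (mem_common.1 hz).1
  split_ifs with h7
  -- The first slice determines the label from the point, because the labels are nonzero.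
  · have hinj : (D.common T p p' q q').card ≤ (D.zeros m.2).card := by
      refine Finset.card_le_card_of_injOn Prod.fst hz ?_
      intro z hz z' hz' h
      have := (h0 z hz).symm.trans ((congrArg (fun w => m.1 (D.vec w)) h).trans (h0 z' hz'))
      exact Prod.ext h (Subtype.ext (mul_left_cancel₀ (mul_ne_zero (hne _) (hne _)) this))
    rw [cornerCount, if_pos (h7.trans hinj)]
    rw [← Finset.sum_product', ← Finset.card_filter]
    refine Finset.card_le_card_of_injOn (fun z => (z.1, (z.2 : F))) (fun z hz' => ?_) ?_
    · simp only [Finset.mem_coe, Finset.mem_filter, Finset.mem_product]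
      exact ⟨⟨hz z hz', z.2.2⟩, h0 z hz'⟩
    · intro z _ z' _ h
      obtain ⟨h1, h2⟩ := Prod.mk.inj h
      exact Prod.ext h1 (Subtype.ext h2)
  · exact Nat.zero_le _

/-- Otherwise the part of size seven would consist of common neighbours of the other two parts, and
any edge of the copy would be bad for the order `π`. -/
theorem exists_notMem_kept (hC : (0 : F) ∉ C) (T : Form F K) (π : Equiv.Perm (Fin 3))
    (y : ∀ i : Fin 3, Fin ((![2, 2, 7] : Fin 3 → ℕ) i) → K × C)
    (hy : ∀ i, Function.Injective (y i)) :
    ∃ c : ∀ i : Fin 3, Fin ((![2, 2, 7] : Fin 3 → ℕ) i),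
      (fun j => y (π j) (c (π j))) ∉ kept D C T := by
  classical
  by_contra! hcon
  have hne : ∀ a : C, (a : F) ≠ 0 := fun a h => hC (h ▸ a.2)
  let p : Fin 2 → K × C := y 0
  let q : Fin 2 → K × C := y 1
  let z : Fin 7 → K × C := y 2
  have hp : Function.Injective p := hy 0
  have hq : Function.Injective q := hy 1
  have hz : Function.Injective z := hy 2
  have hmem : ∀ a b c, (![p a, q b, z c] : Fin 3 → K × C) ∘ π ∈ kept D C T := by
    intro a b c
    convert hcon (fun i => match i with
      | 0 => a
      | 1 => b
      | 2 => c) using 1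
    funext j
    simp only [Function.comp_apply]
    generalize π j = i
    fin_cases i <;> rfl
  have hE : ∀ a b c, D.Edge (T.domDomCongr π) ![p a, q b, z c] := fun a b c =>
    edge_domDomCongr.2 (Finset.mem_filter.1 (hmem a b c)).2.1
  have hcom : ∀ c, z c ∈ D.common (T.domDomCongr π) (p 0) (p 1) (q 0) (q 1) := fun c =>
    mem_common.2 ⟨hE _ _ _, hE _ _ _, hE _ _ _, hE _ _ _⟩
  refine (Finset.mem_filter.1 (hmem 0 0 0)).2.2 π ⟨p 1, q 1, ?_, ?_, ?_, ?_⟩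
  -- Two vertices with the same point but different labels cannot share a related pair, since the
  -- labels are nonzero.
  · intro h
    simp only [Function.comp_apply, Equiv.apply_symm_apply, Matrix.cons_val_zero] at h
    refine absurd (hp (Prod.ext h (Subtype.ext ?_))) (by decide : (0 : Fin 2) ≠ 1)
    have h1 := edge_iff.1 (hE 0 0 0)
    have h2 := edge_iff.1 (hE 1 0 0)
    rw [h, h2] at h1
    exact (mul_right_cancel₀ (hne _) (mul_right_cancel₀ (hne _) h1)).symm
  · intro h
    simp only [Function.comp_apply, Equiv.apply_symm_apply, Matrix.cons_val_one,
      Matrix.cons_val_zero] at h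
    refine absurd (hq (Prod.ext h (Subtype.ext ?_))) (by decide : (0 : Fin 2) ≠ 1)
    have h1 := edge_iff.1 (hE 0 0 0)
    have h2 := edge_iff.1 (hE 0 1 0)
    rw [h, h2] at h1
    exact (mul_left_cancel₀ (hne _) (mul_right_cancel₀ (hne _) h1)).symm
  · simpa using hcom 0
  · have : Fintype.card (Fin 7) ≤
        (D.common (T.domDomCongr π) (p 0) (p 1) (q 0) (q 1)).card := by
      rw [← Finset.card_univ]
      exact Finset.card_le_card_of_injOn z (fun c _ => hcom c) hz.injOn
    simpa using this

variable [Fintype F]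

open scoped Classical in
theorem card_mul_sum_edge :
    Fintype.card F * ∑ T : Form F K, (Finset.univ.filter fun x : Fin 3 → K × C => D.Edge T x).card =
      Fintype.card (Form F K) * Fintype.card (K × C) ^ 3 := by
  simp only [Finset.card_filter]
  rw [Finset.sum_comm, Finset.mul_sum]
  have h : ∀ x : Fin 3 → K × C,
      Fintype.card F * ∑ T : Form F K, (if D.Edge T x then 1 else 0) = Fintype.card (Form F K) := by
    intro x
    have := card_mul_sum_apply (x := fun i => D.vec (x i).1)
      (fun i => vec_linearIndependent_one (D := D) (x i).1) (∏ i, ((x i).2 : F))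
    unfold Edge
    convert this
  simp only [h, Finset.sum_const, Finset.card_univ, Fintype.card_fun, Fintype.card_fin, smul_eq_mul]
  ring

theorem sum_cornerCount_le (hK : Nat.card K = Fintype.card F ^ 3) (ht : 16 ≤ Fintype.card F)
    (c : F) : ∑ m, cornerCount D C c m ≤ 12 * C.card * Fintype.card F ^ 26 := by
  classical
  have h : ∀ (w : K) (y : F), ∑ m : F × K × K × F →ₗ[F] F, (if m (D.vec w) = y then 1 else 0) =
      Fintype.card F ^ 7 := by
    intro w y
    have h1 := card_mul_sum_form_apply (vec_linearIndependent_one (F := F) (D := D) w) y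
    rw [card_dual hK] at h1
    refine Nat.eq_of_mul_eq_mul_left (Fintype.card_pos (α := F)) ?_
    calc _ = _ := h1
      _ = _ := by ring
  rw [Fintype.sum_prod_type_right]
  calc ∑ f : Fin 3 → (F × K × K × F →ₗ[F] F), ∑ m, cornerCount D C c (m, f)
      = ∑ f, (C.card * Fintype.card F ^ 7) *
          (if 7 ≤ (D.zeros f).card then (D.zeros f).card else 0) := by
        refine Finset.sum_congr rfl fun f _ => ?_
        unfold cornerCount
        split_ifs
        · dsimp only
          rw [Finset.sum_comm]
          have : ∀ w ∈ D.zeros f, ∑ m : F × K × K × F →ₗ[F] F,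
              ∑ a ∈ C, (if m (D.vec w) = c * a then 1 else 0) = C.card * Fintype.card F ^ 7 := by
            intro w _
            rw [Finset.sum_comm]
            simp only [h, Finset.sum_const, smul_eq_mul]
          rw [Finset.sum_congr rfl this, Finset.sum_const, smul_eq_mul, mul_comm]
        · simp
    _ ≤ (C.card * Fintype.card F ^ 7) * (12 * Fintype.card F ^ 19) := by
        rw [← Finset.mul_sum]
        exact Nat.mul_le_mul_left _ (sum_card_zeros_le hK ht)
    _ = _ := by ring

/-- By surjectivity of `corners` the average over `T` is the average of `cornerCount` over `t ^ 32`
tuples of forms, whose sum is at most `12 * C.card * t ^ 26`. -/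
theorem sum_card_common_le (hK : Nat.card K = Fintype.card F ^ 3) (ht : 16 ≤ Fintype.card F)
    (hC : (0 : F) ∉ C) {p p' q q' : K × C} (hp : p.1 ≠ p'.1) (hq : q.1 ≠ q'.1) :
    Fintype.card F ^ 6 * ∑ T : Form F K,
      (if 7 ≤ (D.common T p p' q q').card then (D.common T p p' q q').card else 0) ≤
      12 * C.card * Fintype.card (Form F K) := by
  have hne : ∀ a : C, (a : F) ≠ 0 := fun a h => hC (h ▸ a.2)
  have hu : ∀ {a b : K}, a ≠ b → LinearIndependent F ![D.vec a, D.vec b] := fun {a b} hab => by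
    convert linearIndependent_two (D := D) hab using 1
    funext i
    fin_cases i <;> rfl
  have h1 := card_mul_sum_comp_surjective _ (corners_surjective (hu hp) (hu hq)
    (ψ := ![![(p.2 : F) * q.2, (p.2 : F) * q'.2], ![(p'.2 : F) * q.2, (p'.2 : F) * q'.2]])
    (mul_ne_zero (hne _) (hne _))) (cornerCount D C ((p.2 : F) * q.2))
  have h2 := sum_cornerCount_le (D := D) (C := C) hK ht ((p.2 : F) * q.2)
  have h3 := Finset.sum_le_sum fun (T : Form F K) (_ : T ∈ Finset.univ) =>
    card_common_le (D := D) hC T p p' q q'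
  rw [Fintype.card_prod, Fintype.card_fun, Fintype.card_fin, card_dual hK] at h1
  refine Nat.le_of_mul_le_mul_left ?_ (pow_pos (Fintype.card_pos (α := F)) 26)
  calc _ ≤ Fintype.card F ^ 26 * (Fintype.card F ^ 6 * _) :=
        Nat.mul_le_mul_left _ (Nat.mul_le_mul_left _ h3)
    _ = Fintype.card F ^ 8 * (Fintype.card F ^ 8) ^ 3 * _ := by ring
    _ = _ := h1
    _ ≤ _ := Nat.mul_le_mul_left _ h2
    _ = _ := by ring

open scoped Classical in
theorem sum_card_bad_le (hK : Nat.card K = Fintype.card F ^ 3) (ht : 16 ≤ Fintype.card F)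
    (hC : (0 : F) ∉ C) :
    Fintype.card F ^ 6 *
      ∑ T : Form F K, (Finset.univ.filter fun x : Fin 3 → K × C => D.Bad T x).card ≤
      Fintype.card (K × C) ^ 4 * (12 * C.card * Fintype.card (Form F K)) := by
  let Q : Finset ((K × C) × (K × C) × (K × C) × (K × C)) :=
    Finset.univ.filter fun s => s.1.1 ≠ s.2.1.1 ∧ s.2.2.1.1 ≠ s.2.2.2.1
  have h : ∀ T : Form F K, (Finset.univ.filter fun x : Fin 3 → K × C => D.Bad T x).card ≤
      ∑ s ∈ Q, if 7 ≤ (D.common T s.1 s.2.1 s.2.2.1 s.2.2.2).card then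
        (D.common T s.1 s.2.1 s.2.2.1 s.2.2.2).card else 0 := by
    intro T
    rw [← Finset.sum_filter, ← Finset.card_sigma]
    refine Finset.card_le_card_of_surjOn (fun s => ![s.1.1, s.1.2.2.1, s.2]) ?_
    intro x hx
    obtain ⟨p, q, hp, hq, hx2, h7⟩ := (Finset.mem_filter.1 hx).2
    refine ⟨⟨(x 0, p, x 1, q), x 2⟩, ?_, ?_⟩
    · simp only [Q, Finset.mem_coe, Finset.mem_sigma, Finset.mem_filter, Finset.mem_univ, true_and]
      exact ⟨⟨⟨hp, hq⟩, h7⟩, hx2⟩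
    · funext i
      fin_cases i <;> rfl
  calc _ ≤ Fintype.card F ^ 6 * ∑ T : Form F K, ∑ s ∈ Q, _ :=
        Nat.mul_le_mul_left _ (Finset.sum_le_sum fun T _ => h T)
    _ = ∑ s ∈ Q, Fintype.card F ^ 6 * ∑ T : Form F K, _ := by
        rw [Finset.sum_comm, Finset.mul_sum]
    _ ≤ ∑ s ∈ Q, 12 * C.card * Fintype.card (Form F K) :=
        Finset.sum_le_sum fun s hs => by
          obtain ⟨-, hp, hq⟩ := Finset.mem_filter.1 hs
          exact sum_card_common_le hK ht hC hp hq
    _ ≤ _ := by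
        rw [Finset.sum_const, smul_eq_mul]
        refine Nat.mul_le_mul_right _ ((Finset.card_le_univ _).trans (le_of_eq ?_))
        simp only [Fintype.card_prod]
        ring

theorem exists_card_kept (hK : Nat.card K = Fintype.card F ^ 3) (ht : 16 ≤ Fintype.card F)
    (hC : (0 : F) ∉ C) (hCt : 12 * C.card ≤ Fintype.card F) :
    ∃ T : Form F K, Fintype.card (K × C) ^ 3 ≤ 2 * Fintype.card F * (kept D C T).card := by
  classical
  by_contra! hcon
  set t := Fintype.card F
  set N := Fintype.card (K × C) with hN
  have hNt : N = t ^ 3 * C.card := by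
    rw [hN, Fintype.card_prod, Fintype.card_coe, ← Nat.card_eq_fintype_card, hK]
  set M := Fintype.card (Form F K)
  have hM : 0 < M := Fintype.card_pos
  let bad : Form F K → ℕ := fun T => (Finset.univ.filter fun x : Fin 3 → K × C => D.Bad T x).card
  have hbad : t ^ 6 * ∑ T, bad T ≤ N ^ 4 * (12 * C.card * M) := sum_card_bad_le hK ht hC
  -- Permuting the arguments is a bijection on forms, so each of the six orders contributes equally.
  have hperm : ∑ T : Form F K, ∑ π : Equiv.Perm (Fin 3), bad (T.domDomCongr π) =
      6 * ∑ T, bad T := by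
    rw [Finset.sum_comm]
    have : ∀ π : Equiv.Perm (Fin 3), ∑ T : Form F K, bad (T.domDomCongr π) = ∑ T, bad T := fun π =>
      Equiv.sum_comp (MultilinearMap.domDomCongrEquiv (R := F) (M₂ := F × K × K × F) (M₃ := F) π
        ).toEquiv bad
    rw [Finset.sum_congr rfl fun π _ => this π, Finset.sum_const, Finset.card_univ,
      Fintype.card_perm, Fintype.card_fin, smul_eq_mul]
    rfl
  have hE := card_mul_sum_edge (D := D) (C := C)
  have h1 : ∑ T : Form F K, 2 * t * (kept D C T).card < M * N ^ 3 := by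
    calc _ < ∑ T : Form F K, N ^ 3 :=
          Finset.sum_lt_sum_of_nonempty Finset.univ_nonempty fun T _ => hcon T
      _ = _ := by simp [M]
  have h2 : 2 * (M * N ^ 3) ≤ ∑ T : Form F K, 2 * t * (kept D C T).card +
      2 * t * (6 * ∑ T, bad T) := by
    rw [← hE, ← hperm, ← Finset.mul_sum, ← mul_add, ← Finset.sum_add_distrib, ← mul_assoc]
    exact Nat.mul_le_mul_left _ (Finset.sum_le_sum fun T _ => card_edge_le T)
  -- The related triples number `M * N ^ 3 / t` in total, so at most half are deleted. This is where
  -- `12 * C.card ≤ t` enters, squared: one factor comes from `N`, the other from the label count.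
  have h3 : t ^ 6 * (2 * t * (6 * ∑ T, bad T)) ≤ t ^ 6 * (M * N ^ 3) := by
    calc _ = 12 * t * (t ^ 6 * ∑ T, bad T) := by ring
      _ ≤ 12 * t * (N ^ 4 * (12 * C.card * M)) := Nat.mul_le_mul_left _ hbad
      _ = (12 * C.card) ^ 2 * t ^ 4 * (M * N ^ 3) := by
          rw [pow_succ N 3]
          nth_rw 2 [hNt]
          ring
      _ ≤ t ^ 2 * t ^ 4 * (M * N ^ 3) := by gcongr
      _ = _ := by ring
  have h4 := Nat.le_of_mul_le_mul_left h3 (pow_pos (by omega) 6)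
  omega

end CubicData

end CubicCircle

/-! ### From sets of triples to the Turán number -/

namespace Hypergraph

theorem completePartite_edgeSet_nonempty :
    (completePartite (r := 3) ![2, 2, 7]).edgeSet.Nonempty :=
  ⟨_, fun i => match i with
    | 0 => (0 : Fin 2)
    | 1 => (0 : Fin 2)
    | 2 => (0 : Fin 7), rfl⟩

section Tripartite

variable {W : Type*} {n : ℕ} (ι : Fin 3 × W ↪ Fin n) (S : Finset (Fin 3 → W))

/-- The tripartite `3`-graph on `Fin n` given by a set of triples. -/
def ofTriples : Hypergraph (Fin n) where
  vertexSet := Set.univ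
  edgeSet := (fun x : Fin 3 → W => Set.range fun i => ι (i, x i)) '' S
  subset_vertexSet_of_mem_edgeSet' := fun _ _ => Set.subset_univ _

theorem isUniform_ofTriples : (ofTriples ι S).IsUniform 3 := by
  rintro _ ⟨x, -, rfl⟩
  have : Function.Injective fun i => ι (i, x i) := fun i j h =>
    congrArg Prod.fst (ι.injective h)
  change (Set.range fun i => ι (i, x i)).encard = _
  rw [← Set.image_univ, this.encard_image]
  simp

theorem ncard_edgeSet_ofTriples : (ofTriples ι S).edgeSet.ncard = S.card := by
  have : Function.Injective fun x : Fin 3 → W => Set.range fun i => ι (i, x i) := by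
    intro x y h
    funext i
    have hi : ι (i, x i) ∈ Set.range fun i => ι (i, y i) := by
      have h' : (Set.range fun i => ι (i, x i)) = Set.range fun i => ι (i, y i) := h
      rw [← h']
      exact ⟨i, rfl⟩
    obtain ⟨j, hj⟩ := hi
    have := ι.injective hj
    obtain ⟨rfl, h2⟩ := Prod.mk.inj this
    exact h2.symm
  rw [ofTriples, Set.ncard_image_of_injective _ this, Set.ncard_coe_finset]

variable {ι S}

/-- Every edge meets each part of the host once, so a copy sends each of its parts into a single
host part, and distinct parts into distinct ones. This yields the permutation. -/
theorem isFree_ofTriples {s : Fin 3 → ℕ} (hs : ∀ i, 0 < s i)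
    (hS : ∀ (π : Equiv.Perm (Fin 3)) (y : ∀ i : Fin 3, Fin (s i) → W),
      (∀ i, Function.Injective (y i)) →
      ∃ c : ∀ i : Fin 3, Fin (s i), (fun j => y (π j) (c (π j))) ∉ S) :
    (ofTriples ι S).IsFree (completePartite s) := by
  classical
  rintro ⟨f, hinj, -, hf⟩
  have hfi : Function.Injective f := fun a b h => hinj (Set.mem_univ _) (Set.mem_univ _) h
  have hedge : ∀ c : ∀ i, Fin (s i), ∃ x ∈ S, ∀ i, ∃ j, f ⟨i, c i⟩ = ι (j, x j) := by
    intro c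
    obtain ⟨x, hx, h⟩ := hf _ ⟨c, rfl⟩
    refine ⟨x, hx, fun i => ?_⟩
    have hi : f ⟨i, c i⟩ ∈ Set.range fun i => ι (i, x i) := by
      have h' : (Set.range fun i => ι (i, x i)) =
        f '' Set.range fun i => (⟨i, c i⟩ : Σ i : Fin 3, Fin (s i)) := h
      rw [h']
      exact ⟨_, ⟨i, rfl⟩, rfl⟩
    obtain ⟨j, hj⟩ := hi
    exact ⟨j, hj.symm⟩
  let c₀ : ∀ i, Fin (s i) := fun i => ⟨0, hs i⟩
  have hg : ∀ v : Σ i : Fin 3, Fin (s i), ∃ w, f v = ι w := by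
    rintro ⟨i, k⟩
    obtain ⟨x, -, hx⟩ := hedge (Function.update c₀ i k)
    obtain ⟨j, hj⟩ := hx i
    rw [Function.update_self] at hj
    exact ⟨_, hj⟩
  choose g hg using hg
  have hgi : Function.Injective g := fun a b h => hfi (by rw [hg, hg, h])
  have hx : ∀ c : ∀ i, Fin (s i), ∃ x ∈ S, ∀ i, (g ⟨i, c i⟩).2 = x (g ⟨i, c i⟩).1 := by
    intro c
    obtain ⟨x, hx, h⟩ := hedge c
    refine ⟨x, hx, fun i => ?_⟩
    obtain ⟨j, hj⟩ := h i
    rw [hg] at hj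
    rw [ι.injective hj]
  have hpart : ∀ c : ∀ i, Fin (s i), Function.Injective fun i => (g ⟨i, c i⟩).1 := by
    intro c i i' h
    obtain ⟨x, -, hx⟩ := hx c
    have h' : (g ⟨i, c i⟩).1 = (g ⟨i', c i'⟩).1 := h
    have : g ⟨i, c i⟩ = g ⟨i', c i'⟩ := Prod.ext h' (by rw [hx, hx, h'])
    exact congrArg Sigma.fst (hgi this)
  let π := Equiv.ofBijective _ (Finite.injective_iff_bijective.1 (hpart c₀))
  -- Changing one vertex of the transversal `c₀` leaves the host parts of the other two unchanged,
  -- which forces that of the new vertex.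
  have hπ : ∀ i k, (g ⟨i, k⟩).1 = π i := by
    intro i k
    obtain ⟨i', hi'⟩ := π.surjective (g ⟨i, k⟩).1
    by_cases h : i' = i
    · rw [← hi', h]
    · refine absurd (hpart (Function.update c₀ i k) ?_) h
      simp only [Function.update_self]
      rw [Function.update_of_ne h, ← hi']
      rfl
  obtain ⟨c, hc⟩ := hS π.symm (fun i k => (g ⟨i, k⟩).2) (fun i k k' h => by
    have := hgi (Prod.ext ((hπ i k).trans (hπ i k').symm) h)
    simpa using this)
  obtain ⟨x, hxS, hx⟩ := hx c
  refine hc ?_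
  convert hxS using 1
  funext j
  rw [hx, hπ, Equiv.apply_symm_apply]

theorem card_le_turanNumber [Fintype W] (hn : 3 * Fintype.card W ≤ n)
    (hS : ∀ (π : Equiv.Perm (Fin 3)) (y : ∀ i : Fin 3, Fin ((![2, 2, 7] : Fin 3 → ℕ) i) → W),
      (∀ i, Function.Injective (y i)) →
      ∃ c : ∀ i : Fin 3, Fin ((![2, 2, 7] : Fin 3 → ℕ) i), (fun j => y (π j) (c (π j))) ∉ S) :
    S.card ≤ turanNumber 3 n (completePartite (r := 3) ![2, 2, 7]) := by
  obtain ⟨ι⟩ : Nonempty (Fin 3 × W ↪ Fin n) :=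
    Function.Embedding.nonempty_of_card_le (by simpa using hn)
  refine (isGreatest_turanNumber 3 n _ completePartite_edgeSet_nonempty).2
    ⟨ofTriples ι S, rfl, isUniform_ofTriples ι S, isFree_ofTriples ?_ hS,
      ncard_edgeSet_ofTriples ι S⟩
  intro i
  fin_cases i <;> simp

end Tripartite

end Hypergraph

/-! ### The choice of the prime and the asymptotics -/

namespace CubicCircle

theorem fixed_of_pow_eq {p : ℕ} [Fact p.Prime] (x : GaloisField p 3) (hx : x ^ p = x) :
    ∃ r : ZMod p, algebraMap (ZMod p) (GaloisField p 3) r = x := by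
  obtain ⟨k, hk⟩ := (mem_bot_iff_intCast p (GaloisField p 3)).1
    ((Subfield.mem_bot_iff_pow_eq_self _ p).2 hx)
  exact ⟨k, by rw [map_intCast, hk]⟩

theorem pow_cube_eq {p : ℕ} [Fact p.Prime] (x : GaloisField p 3) :
    ((x ^ p) ^ p) ^ p = x := by
  have : Fintype (GaloisField p 3) := Fintype.ofFinite _
  have h := FiniteField.pow_card x
  rw [← Nat.card_eq_fintype_card, GaloisField.card p 3 (by norm_num)] at h
  rw [← pow_mul, ← pow_mul]
  convert h using 2
  ring

/-- The cubic extension of a prime field. -/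
noncomputable def galoisCubic (p : ℕ) [Fact p.Prime] : CubicData (ZMod p) (GaloisField p 3) :=
  have h : ∀ x : GaloisField p 3, FiniteField.frobeniusAlgHom (ZMod p) (GaloisField p 3) x = x ^ p :=
    fun x => by simp
  have hN : ∀ x : GaloisField p 3, ∃ r : ZMod p, algebraMap (ZMod p) (GaloisField p 3) r =
      x * x ^ p * (x ^ p) ^ p := fun x => fixed_of_pow_eq _ (by
    rw [mul_pow, mul_pow, pow_cube_eq]; ring)
  { σ := FiniteField.frobeniusAlgHom (ZMod p) (GaloisField p 3)
    cube := fun x => by rw [h, h, h, pow_cube_eq]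
    fixed := fun x hx => fixed_of_pow_eq x (by rw [← h, hx])
    nm := fun x => (hN x).choose
    nm_eq := fun x => by rw [h, h]; exact (hN x).choose_spec }

/-- Take `m` maximal with `48 * m ^ 4 ≤ n` and a prime `m < p ≤ 2 * m`. Then `3 * p ^ 4 ≤ 48 * m ^
4`, and `n < 48 * (m + 1) ^ 4 ≤ (4 * p) ^ 4`. -/
theorem exists_prime_le {n : ℕ} (hn : 48 * 16 ^ 4 ≤ n) :
    ∃ p : ℕ, p.Prime ∧ 16 ≤ p ∧ 3 * p ^ 4 ≤ n ∧ n ≤ (4 * p) ^ 4 := by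
  obtain ⟨m, hm, hm'⟩ : ∃ m : ℕ, 48 * m ^ 4 ≤ n ∧ n < 48 * (m + 1) ^ 4 := by
    have h0 : 48 * 0 ^ 4 ≤ n := by simp
    refine ⟨Nat.findGreatest (fun m => 48 * m ^ 4 ≤ n) n,
      Nat.findGreatest_spec (P := fun m => 48 * m ^ 4 ≤ n) (Nat.zero_le n) h0, ?_⟩
    by_contra! h
    have h1 : Nat.findGreatest (fun m => 48 * m ^ 4 ≤ n) n + 1 ≤ n :=
      (Nat.le_self_pow (by norm_num) _).trans ((Nat.le_mul_of_pos_left _ (by norm_num)).trans h)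
    exact absurd (Nat.le_findGreatest (P := fun m => 48 * m ^ 4 ≤ n) h1 h) (by omega)
  have h16 : 16 ≤ m := by
    by_contra! h
    have : (m + 1) ^ 4 ≤ 16 ^ 4 := Nat.pow_le_pow_left (by omega) 4
    omega
  obtain ⟨p, hp, hmp, hpm⟩ := Nat.exists_prime_lt_and_le_two_mul m (by omega)
  have h1 : p ^ 4 ≤ (2 * m) ^ 4 := Nat.pow_le_pow_left hpm 4
  have h2 : (m + 1) ^ 4 ≤ p ^ 4 := Nat.pow_le_pow_left hmp 4
  rw [mul_pow] at h1
  refine ⟨p, hp, by omega, by omega, ?_⟩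
  rw [mul_pow]
  omega

theorem pow_le_turanNumber {p n : ℕ} (hp : p.Prime) (h16 : 16 ≤ p) (hn : 3 * p ^ 4 ≤ n) :
    p ^ 11 ≤ 27648 * Hypergraph.turanNumber 3 n (Hypergraph.completePartite (r := 3) ![2, 2, 7]) := by
  classical
  have := Fact.mk hp
  have : Fintype (GaloisField p 3) := Fintype.ofFinite _
  have hF : Fintype.card (ZMod p) = p := ZMod.card p
  have hK : Nat.card (GaloisField p 3) = Fintype.card (ZMod p) ^ 3 := by
    rw [hF, GaloisField.card p 3 (by norm_num)]
  obtain ⟨C, hC, hCp⟩ := Finset.exists_subset_card_eq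
    (s := (Finset.univ : Finset (ZMod p)).erase 0) (n := p / 12) (by
      rw [Finset.card_erase_of_mem (Finset.mem_univ _), Finset.card_univ, hF]; omega)
  have hC0 : (0 : ZMod p) ∉ C := fun h => by simpa using hC h
  obtain ⟨T, hT⟩ := CubicData.exists_card_kept (D := galoisCubic p) (C := C) hK (by rw [hF]; exact h16)
    hC0 (by rw [hF, hCp]; omega)
  have hN : Fintype.card (GaloisField p 3 × C) = p ^ 3 * (p / 12) := by
    rw [Fintype.card_prod, Fintype.card_coe, hCp, ← Nat.card_eq_fintype_card, hK, hF]
  have hle := Hypergraph.card_le_turanNumber (n := n)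
    (S := CubicData.kept (galoisCubic p) C T) (by
      rw [hN]
      refine le_trans (Nat.mul_le_mul_left 3 ?_) hn
      rw [pow_succ p 3]
      exact Nat.mul_le_mul_left _ (Nat.div_le_self p 12))
    (CubicData.exists_notMem_kept hC0 T)
  rw [hN, hF] at hT
  set s := Hypergraph.turanNumber 3 n (Hypergraph.completePartite (r := 3) ![2, 2, 7])
  -- The rounding of `p / 12` costs at most a factor two, whence `27648 = 2 * 24 ^ 3`.
  have hdiv : p ≤ 24 * (p / 12) := by omega
  refine Nat.le_of_mul_le_mul_left ?_ hp.pos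
  calc p * p ^ 11 = (p ^ 3 * p) ^ 3 := by ring
    _ ≤ (p ^ 3 * (24 * (p / 12))) ^ 3 := by gcongr
    _ = 13824 * (p ^ 3 * (p / 12)) ^ 3 := by ring
    _ ≤ 13824 * (2 * p * s) := Nat.mul_le_mul_left _ (hT.trans (Nat.mul_le_mul_left _ hle))
    _ = _ := by ring

/-- The Turán number of `K_{2,2,7}` is at least of order `n ^ (11 / 4)`. -/
theorem rpow_le_turanNumber {n : ℕ} (hn : 48 * 16 ^ 4 ≤ n) :
    (n : ℝ) ^ (11 / 4 : ℝ) ≤ 4 ^ 11 * (27648 *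
      (Hypergraph.turanNumber 3 n (Hypergraph.completePartite (r := 3) ![2, 2, 7]) : ℝ)) := by
  obtain ⟨p, hp, h16, h3, h4⟩ := exists_prime_le hn
  have h := pow_le_turanNumber hp h16 h3
  have hR : (p : ℝ) ^ 11 ≤ 27648 *
      (Hypergraph.turanNumber 3 n (Hypergraph.completePartite (r := 3) ![2, 2, 7]) : ℝ) := by
    exact_mod_cast h
  have h4' : (n : ℝ) ≤ (4 * p) ^ 4 := by exact_mod_cast h4
  calc (n : ℝ) ^ (11 / 4 : ℝ) ≤ ((4 * p : ℝ) ^ 4) ^ (11 / 4 : ℝ) :=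
        Real.rpow_le_rpow (Nat.cast_nonneg _) h4' (by norm_num)
    _ = (4 * p : ℝ) ^ 11 := by
        rw [← Real.rpow_natCast, ← Real.rpow_mul (by positivity), ← Real.rpow_natCast]
        norm_num
    _ = 4 ^ 11 * (p : ℝ) ^ 11 := by rw [mul_pow]
    _ ≤ _ := by gcongr

theorem eventually_le_turanNumber : ∀ᶠ n : ℕ in atTop,
    (1 / 27 : ℝ) * (n : ℝ) ^ (19 / 7 : ℝ) ≤
      (Hypergraph.turanNumber 3 n (Hypergraph.completePartite (r := 3) ![2, 2, 7]) : ℝ) := by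
  have ht : Tendsto (fun n : ℕ => (n : ℝ) ^ (1 / 28 : ℝ)) atTop atTop :=
    (tendsto_rpow_atTop (by norm_num)).comp tendsto_natCast_atTop_atTop
  -- The surplus factor `n ^ (1 / 28)` absorbs the constants; `1024 = 27648 / 27`.
  filter_upwards [ht.eventually_ge_atTop (4 ^ 11 * 1024), eventually_ge_atTop (48 * 16 ^ 4)]
    with n h1 h2
  have h := rpow_le_turanNumber h2
  have hpos : (0 : ℝ) < n := by exact_mod_cast (by omega : 0 < n)
  rw [show (11 / 4 : ℝ) = 1 / 28 + 19 / 7 by norm_num, Real.rpow_add hpos] at h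
  have h3 : (4 ^ 11 * 1024 : ℝ) * (n : ℝ) ^ (19 / 7 : ℝ) ≤
      (n : ℝ) ^ (1 / 28 : ℝ) * (n : ℝ) ^ (19 / 7 : ℝ) := by gcongr
  linarith

end CubicCircle

theorem theorem1p8 :
    ∃ h : ℕ → ℝ, h =o[atTop] (fun n : ℕ => (n : ℝ) ^ (19 / 7 : ℝ)) ∧
      ∀ n : ℕ, (1 / 27 : ℝ) * (n : ℝ) ^ (19 / 7 : ℝ) + h n ≤
        (Hypergraph.turanNumber 3 n (Hypergraph.completePartite (r := 3) ![2, 2, 7]) : ℝ) := by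
  -- The error term is the deficit where the bound fails, and is zero for all large `n`.
  refine ⟨fun n => min 0 ((Hypergraph.turanNumber 3 n
    (Hypergraph.completePartite (r := 3) ![2, 2, 7]) : ℝ) - (1 / 27 : ℝ) * (n : ℝ) ^ (19 / 7 : ℝ)),
    ?_, fun n => ?_⟩
  · refine (isLittleO_zero _ _).congr' ?_ EventuallyEq.rfl
    filter_upwards [CubicCircle.eventually_le_turanNumber] with n hn
    rw [min_eq_left (sub_nonneg.2 hn)]
  · linarith [min_le_right 0 ((Hypergraph.turanNumber 3 n
      (Hypergraph.completePartite (r := 3) ![2, 2, 7]) : ℝ) -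
        (1 / 27 : ℝ) * (n : ℝ) ^ (19 / 7 : ℝ))]
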